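/- **Setting.** Fix $c\in\mathbb R$ and put $\phi(x)=(x-c)^2$. A map of class $\mathcal T$ is a map $g:\bigcup_k I_k\to J$, where $J$ is a compact interval symmetric about $c$ and $\{I_k\}$ is a (finite or infinite) family of pairwise disjoint nondegenerate compact subintervals of $J$, such that the central interval $I_0\ni c$ is symmetric about $c$ and contained in the interior of $J$, and $g|I_k=h_k\circ\phi$ for every $k$, where $h_k$ is a $C^3$ diffeomorphism with negative Schwarzian derivative of a compact interval $A_k$ onto $J$. For $k\neq 0$, $A_k=\phi(I_k)$ (so $g$ maps $I_k$ diffeomorphically onto $J$); for $k=0$, $A_0\supset\phi(I_0)$ has the same right endpoint as $\phi(I_0)$ (so $g|I_0$ is unimodal and $g(\partial I_0)\subset\partial J$). Let $g_1\in\mathcal T$ have a recurrent critical point: the orbit of $c$ is defined for all times and $c\in\omega(c)$. Define inductively $g_{n+1}:\bigcup_k I^{n+1}_k\to I^n$ as the first return map of $g_n:\bigcup_k I_k^n\to I^{n-1}$ to its central interval $I^n=I^n_0$, restricted to those components of its domain that meet $\omega(c)$. If $I^{n+1}_k$ has return time $l$, then $g_{n+1}|I^{n+1}_k=h_{n+1,k}\circ\phi$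 with $h_{n+1,k}=g_n^{\,l-1}\circ h_{n,0}$, taken on the preimage under $h_{n,0}$ of the monotone pull-back of $I^n$ by $g_n^{\,l-1}$ along the orbit of $g_n(I_k^{n+1})$, so that $h_{n+1,k}$ maps onto $I^n$. For an interval $G\subset L$ with complementary components $U,V$ in $L$, let $P(G|L)=\log(1+|G|/|U|)+\log(1+|G|/|V|)$ (which is $\infty$ if $U$ or $V$ is degenerate). For disjoint intervals $U,V$ with gap $G$ not meeting $c$, $U$ being closer to $c$ than $V$ (possibly $c\in U$), let $Q(U,V)=\log(1+|G|/|U|)+\tfrac12\log(1+|G|/|V|)$. The parameters of level $n$ are - $\mu_n=|I^n|/|I^{n-1}|$; - $\lambda_n=\sup_{k\ne0}P(I^n_k|I^{n-1})$ and $\lambda_n^*=\min(\lambda_n,1)$; - $K_n$, the infimum of $Q(I^n_s,I^n_t)$ over all pairs of distinct intervals of level $n$ that lie on the same side of $c$ or one of which is central; - $\rho_n$, the supremum over $k$ of the distortions $\sup_{x,y}\log\bigl(|h_{n,k}'(x)|/|h_{n,k}'(y)|\bigr)$, with $x,y$ in the domain of $h_{n,k}$. **Lemma 3.12.** For every $\bar\mu\in(0,1)$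 there is a constant $C>0$, depending only on $\bar\mu$, with the following property. Let $0<\bar\rho<\bar\mu$ and $\bar K>0$, let $g_1$ be as above, and let $n\ge1$ be a level with $$\rho_n<\bar\rho,\qquad \mu_n<\bar\mu,\qquad K_n>\bar K .$$ Write $\mu=\mu_n$, $\lambda^*=\lambda_n^*$ and $\mu'=\mu_{n+1}$, $\lambda'=\lambda_{n+1}$, $\rho'=\rho_{n+1}$, $K'=K_{n+1}$. Then $$\lambda'\le C\sqrt{\mu},\qquad \mu'\le C\sqrt{\mu},\qquad \rho'\le C\mu,\qquad K'\ge\tfrac12\log\tfrac1\mu-C .$$ If moreover the return is non-central, that is $g_n(c)\notin I^n$, then $$\mu'\le C\sqrt{\mu\,\lambda^*} .$$ -/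

import Mathlib

open scoped ENNReal

noncomputable section

namespace Renorm

/-! ### Poincaré lengths -/

/-- Left endpoint of a bounded interval. -/
def lo (W : Set ℝ) : ℝ := sInf W

/-- Right endpoint of a bounded interval. -/
def hi (W : Set ℝ) : ℝ := sSup W

/-- Length of a bounded interval. -/
def len (W : Set ℝ) : ℝ := hi W - lo W

/-- The number `log (1 + x / y)`, with value `∞` when the denominator vanishes. -/
def logRatio (x y : ℝ) : ℝ≥0∞ :=
  if 0 < y then ENNReal.ofReal (Real.log (1 + x / y)) else ⊤

/-- Poincaré length `P(G | L)` of the interval `G` in the interval `L`. It is `∞` if `G` and `L`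
share an endpoint. -/
def poincareLength (G L : Set ℝ) : ℝ≥0∞ :=
  logRatio (len G) (lo G - lo L) + logRatio (len G) (hi L - hi G)

/-- `IsCloser c U V`: the gap between the intervals `U` and `V` has no interior point equal to `c`,
and `U` is closer to `c` than `V` (`U` may contain `c`). -/
def IsCloser (c : ℝ) (U V : Set ℝ) : Prop :=
  (c ≤ hi U ∧ hi U ≤ lo V) ∨ (hi V ≤ lo U ∧ lo U ≤ c)

/-- Length of the gap between two disjoint intervals. -/
def gapLen (U V : Set ℝ) : ℝ := max (lo V - hi U) (lo U - hi V)

/-- Asymmetric Poincaré length `Q(U, V)` of the gap between `U` and `V`, where `U` is the interval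
closer to the critical point. -/
def asymLength (U V : Set ℝ) : ℝ≥0∞ :=
  logRatio (gapLen U V) (len U) + logRatio (gapLen U V) (len V) / 2

/-! ### Diffeomorphisms with negative Schwarzian derivative -/

/-- Schwarzian derivative. -/
def schwarzian (h : ℝ → ℝ) (z : ℝ) : ℝ :=
  deriv (deriv (deriv h)) z / deriv h z - 3 / 2 * (deriv (deriv h) z / deriv h z) ^ 2

/-- `h` restricts to a `C³` diffeomorphism of the nondegenerate compact interval `A` onto `J`, with
negative Schwarzian derivative. -/
structure IsNegSchwarzDiffeo (h : ℝ → ℝ) (A J : Set ℝ) : Prop where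
  interval : ∃ a b : ℝ, a < b ∧ A = Set.Icc a b
  smooth : ContDiffOn ℝ 3 h A
  deriv_ne : ∀ z ∈ A, derivWithin h A z ≠ 0
  onto : h '' A = J
  neg : ∀ z ∈ interior A, schwarzian h z < 0

/-- Distortion (non-linearity) of `h` on `A`: the supremum of `log (|h' x| / |h' y|)`. -/
def distortion (h : ℝ → ℝ) (A : Set ℝ) : ℝ≥0∞ :=
  ⨆ x ∈ A, ⨆ y ∈ A, ENNReal.ofReal (Real.log (|derivWithin h A x| / |derivWithin h A y|))

/-! ### Maps of class `𝒯` -/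

/-- The data of a map `g : ⋃ I_k → J` together with a decomposition `g | I_k = h_k ∘ φ`,
`φ x = (x - c) ^ 2`. The intervals `I_k` serve as their own indices. Values of `map` outside
`⋃ I_k`, and of `dom`, `diffeo` at sets which are not among the `I_k`, are irrelevant. -/
structure TData where
  /-- the critical point -/
  c : ℝ
  /-- the range `J` -/
  J : Set ℝ
  /-- the family of the intervals `I_k` -/
  pieces : Set (Set ℝ)
  /-- the map `g` -/
  map : ℝ → ℝ
  /-- the domain of definition of `h_k` -/
  dom : Set ℝ → Set ℝ
  /-- the diffeomorphism `h_k` -/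
  diffeo : Set ℝ → ℝ → ℝ

namespace TData

variable (g : TData)

/-- The central interval `I = I_0`, the one containing the critical point. -/
def central : Set ℝ := ⋃₀ {W ∈ g.pieces | g.c ∈ W}

/-- The quadratic map `φ x = (x - c) ^ 2`. -/
def phi (x : ℝ) : ℝ := (x - g.c) ^ 2

/-- Maps of class `𝒯`, with negative Schwarzian derivative and purely quadratic at the critical
point. The interval `J` and the central interval `I ⊂ int J` are symmetric about `c`. On each
interval `I_k` the map is `h_k ∘ φ`, where `h_k` is a diffeomorphism of an interval onto `J` with
negative Schwarzian derivative. For a non-central `I_k` this interval is `φ I_k`, so that `I_k` is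
mapped diffeomorphically onto `J`. For the central one it contains `φ I = [0, r²]` and has the
same right endpoint, so that `g | I` is unimodal and maps `∂I` into `∂J`. -/
structure ClassT : Prop where
  symm : ∃ r R : ℝ, 0 < r ∧ r < R ∧ g.J = Set.Icc (g.c - R) (g.c + R) ∧
    Set.Icc (g.c - r) (g.c + r) ∈ g.pieces
  interval : ∀ W ∈ g.pieces, ∃ a b : ℝ, a < b ∧ W = Set.Icc a b
  subset : ∀ W ∈ g.pieces, W ⊆ g.J
  disj : ∀ U ∈ g.pieces, ∀ V ∈ g.pieces, U ≠ V → Disjoint U V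
  diff : ∀ W ∈ g.pieces, IsNegSchwarzDiffeo (g.diffeo W) (g.dom W) g.J
  decomp : ∀ W ∈ g.pieces, ∀ x ∈ W, g.map x = g.diffeo W (g.phi x)
  dom_noncentral : ∀ W ∈ g.pieces, g.c ∉ W → g.dom W = g.phi '' W
  dom_central : g.phi '' g.central ⊆ g.dom g.central ∧
    hi (g.dom g.central) = hi (g.phi '' g.central)

/-- The limit set `ω(c)` of the critical orbit. -/
def omegaCrit : Set ℝ := {y | MapClusterPt y Filter.atTop (fun n : ℕ => g.map^[n] g.c)}

/-- The critical point is recurrent: its orbit is defined for all times, and `c ∈ ω(c)`. -/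
def Recurrent : Prop := (∀ n : ℕ, g.map^[n] g.c ∈ ⋃₀ g.pieces) ∧ g.c ∈ g.omegaCrit

/-! ### The pre-renormalization: first return map to the central interval -/

/-- The point `x` of `I` returns to `I` for the first time at time `k`. -/
def FirstReturn (x : ℝ) (k : ℕ) : Prop :=
  x ∈ g.central ∧ 0 < k ∧ (∀ j < k, g.map^[j] x ∈ ⋃₀ g.pieces) ∧
    (∀ j, 0 < j → j < k → g.map^[j] x ∉ g.central) ∧ g.map^[k] x ∈ g.central

/-- The first return time of `x`. -/
def returnTime (x : ℝ) : ℕ := sInf {k | g.FirstReturn x k}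

/-- Pull-back of `I` by `g^k` along the orbit of `x`: the points `y` whose `j`-th iterate lies in
the same interval of the family as that of `x`, for `j < k`, and whose `k`-th iterate is in `I`. -/
def pullback (k : ℕ) (x : ℝ) : Set ℝ :=
  {y | (∀ j < k, ∃ W ∈ g.pieces, g.map^[j] x ∈ W ∧ g.map^[j] y ∈ W) ∧ g.map^[k] y ∈ g.central}

/-- The component containing `x` of the domain of the first return map, `k` being the return
time of `x`. -/
def component (k : ℕ) (x : ℝ) : Set ℝ := Set.ordConnectedComponent (g.pullback k x) x

/-- The pre-renormalization `g'` of `g`: the first return map to `I`, restricted to those components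
of its domain which meet `ω(c)`. If `I'_k` is a component with return time `l`, the new
diffeomorphism is `h'_k = g^(l-1) ∘ h_0`, defined on the `h_0`-preimage of the monotone
pull-back of `I` by `g^(l-1)` along the orbit of `g(I'_k)`, so that it maps onto `I`. -/
def prerenorm : TData where
  c := g.c
  J := g.central
  pieces := {W | (∃ x k, g.FirstReturn x k ∧ W = g.component k x) ∧ (W ∩ g.omegaCrit).Nonempty}
  map := fun x => g.map^[g.returnTime x] x
  dom := fun W => {z ∈ g.dom g.central | ∃ x ∈ W, ∃ k, g.FirstReturn x k ∧
    g.diffeo g.central z ∈ g.pullback (k - 1) (g.map x)}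
  diffeo := fun W z => g.map^[sInf (g.returnTime '' W) - 1] (g.diffeo g.central z)

/-- The sequence of pre-renormalized maps; `g.level 0 = g` is the first map of the sequence. -/
def level : ℕ → TData
  | 0 => g
  | n + 1 => (level n).prerenorm

/-! ### Parameters of a level -/

/-- The scaling factor `μ = |I| / |J|`. -/
def mu : ℝ := len g.central / len g.J

/-- `λ`: the supremum of the Poincaré lengths of the non-central intervals in `J`. -/
def lam : ℝ≥0∞ := ⨆ W ∈ g.pieces, ⨆ _ : g.c ∉ W, poincareLength W g.J

/-- `λ* = min (λ, 1)`. -/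
def lamStar : ℝ := (min g.lam 1).toReal

/-- `ρ`: the supremum of the distortions of the diffeomorphisms `h_k`. -/
def rho : ℝ≥0∞ := ⨆ W ∈ g.pieces, distortion (g.diffeo W) (g.dom W)

/-- `K`: the infimum of the asymmetric Poincaré lengths of the gaps between intervals which lie on
the same side of `c`, or one of which is central. -/
def gapK : ℝ≥0∞ := ⨅ U ∈ g.pieces, ⨅ V ∈ g.pieces, ⨅ _ : IsCloser g.c U V, asymLength U V

/-- Non-central return: `g(c)` is not in the central interval. -/
def NonCentralReturn : Prop := g.map g.c ∉ g.central

end TData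

end Renorm

end

/-! Diffeomorphisms with negative Schwarzian derivative expand the cross ratio `|yz| |xw| / (|xy|
|zw|)`, so their inverse branches shrink it. For `I = [c - r, c + r]` in `J = [c - R, c + R]` this
ratio is `4rR / (R - r)²`, at most some `θ = O(μ)` with a constant depending only on the bound for
`μ`. A branch of the first return map is `F ∘ φ` with `F = g^k ∘ h₀`. The intermediate orbit avoids
`I`, so `F` extends monotonically from `[p, q]`, mapped onto `I`, to some `[p', q']` with `q' ≤ r²`,
mapped onto `J`. Hence both collars of `[p, q]` in `[p', q']` have length at least `(q - p) / θ`
(`branch_space`, `left_space`, `right_space`), and the estimates follow.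

Distortion: the Koebe principle (`koebe_right`, `koebe_left`) applied to `F` gives `ρ' = O(μ)`.
Sizes: the intervals of the new level are square roots of `[p, q]`; the root turns `θ` into `√θ`
near `c` and keeps it linear away from `c`, so `λ'` and `μ'` are `O(√μ)`. For a non-central return
`[p', q']` lies in the `h₀`-preimage of the interval containing `g(c)`, whose length is `O(λ) r²`,
and this gains a factor `√λ` in `μ'`.

Gaps: of two branches, the `J`-extension of the one with the longer return time misses the
`I`-pull-back of the other (`eq_of_mem_cylinder`), so its collar fits in the gap (`branch_gap`).
After the square root the outer interval keeps the ratio `θ` and the inner one gets `√θ`; the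
weights `1/2` and `1` in `Q` make both cases worth `½ log (1/θ)`.

What passes from level to level is cross ratio expansion alone (`IsExpanding`), which composition
and restriction preserve. Recurrence keeps the critical orbit off the boundaries, so that the new
central interval does not degenerate. -/

namespace Renorm
open Set Filter Topology
open scoped ENNReal

/-! ### Maps expanding cross ratios -/

/-- `f` is a strictly monotone map of `[a, b]` with nonvanishing derivative which does not decrease
the cross ratios `|yz| |xw| / (|xy| |zw|)`. -/
structure CrossExpanding (f : ℝ → ℝ) (a b : ℝ) : Prop where
  lt : a < b
  deriv : ∀ z ∈ Icc a b, ∃ d, d ≠ 0 ∧ HasDerivWithinAt f d (Icc a b) z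
  mono : StrictMonoOn f (Icc a b) ∨ StrictAntiOn f (Icc a b)
  cross : ∀ x y z w, a ≤ x → x < y → y < z → z < w → w ≤ b →
    (z - y) * (w - x) * (|f y - f x| * |f w - f z|) ≤
      |f z - f y| * |f w - f x| * ((y - x) * (w - z))

namespace CrossExpanding

variable {f h : ℝ → ℝ} {a b a' b' : ℝ}

theorem injOn (hf : CrossExpanding f a b) : InjOn f (Icc a b) :=
  hf.mono.elim (fun m => m.injOn) (fun m => m.injOn)

theorem continuousOn (hf : CrossExpanding f a b) : ContinuousOn f (Icc a b) := fun z hz => by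
  obtain ⟨d, -, hd⟩ := hf.deriv z hz
  exact hd.continuousWithinAt

theorem congr (hf : CrossExpanding f a b) (he : EqOn h f (Icc a b)) : CrossExpanding h a b where
  lt := hf.lt
  deriv z hz := by
    obtain ⟨d, h0, hd⟩ := hf.deriv z hz
    exact ⟨d, h0, hd.congr he (he hz)⟩
  mono := hf.mono.imp (fun m => m.congr he.symm) (fun m => m.congr he.symm)
  cross x y z w h1 h2 h3 h4 h5 := by
    rw [he ⟨h1, by linarith⟩, he (x := y) ⟨by linarith, by linarith⟩,
      he (x := z) ⟨by linarith, by linarith⟩, he (x := w) ⟨by linarith, by linarith⟩]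
    exact hf.cross x y z w h1 h2 h3 h4 h5

theorem restrict (hf : CrossExpanding f a b) (h1 : a ≤ a') (h2 : a' < b') (h3 : b' ≤ b) :
    CrossExpanding f a' b' where
  lt := h2
  deriv z hz := by
    obtain ⟨d, h0, hd⟩ := hf.deriv z ⟨h1.trans hz.1, hz.2.trans h3⟩
    exact ⟨d, h0, hd.mono (Icc_subset_Icc h1 h3)⟩
  mono := hf.mono.imp (fun m => m.mono (Icc_subset_Icc h1 h3))
    (fun m => m.mono (Icc_subset_Icc h1 h3))
  cross x y z w g1 g2 g3 g4 g5 := hf.cross x y z w (h1.trans g1) g2 g3 g4 (g5.trans h3)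

theorem cross_rev (hf : CrossExpanding f a b) {x y z w : ℝ} (h1 : x ≤ b) (h2 : y < x) (h3 : z < y)
    (h4 : w < z) (h5 : a ≤ w) :
    |z - y| * |w - x| * (|f y - f x| * |f w - f z|) ≤
      |f z - f y| * |f w - f x| * (|y - x| * |w - z|) := by
  have := hf.cross w z y x h5 h4 h3 h2 h1
  rw [abs_sub_comm z y, abs_sub_comm w x, abs_sub_comm y x, abs_sub_comm w z,
    abs_of_pos (sub_pos.2 h3), abs_of_pos (sub_pos.2 h2), abs_of_pos (sub_pos.2 h4),
    abs_of_pos (sub_pos.2 (h4.trans (h3.trans h2))), abs_sub_comm (f y), abs_sub_comm (f w) (f z),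
    abs_sub_comm (f z) (f y), abs_sub_comm (f w) (f x)]
  linarith

theorem comp (hf : CrossExpanding f a' b') (hh : CrossExpanding h a b)
    (hm : MapsTo h (Icc a b) (Icc a' b')) : CrossExpanding (f ∘ h) a b where
  lt := hh.lt
  deriv z hz := by
    obtain ⟨d, h0, hd⟩ := hh.deriv z hz
    obtain ⟨e, k0, he⟩ := hf.deriv (h z) (hm hz)
    exact ⟨e * d, mul_ne_zero k0 h0, he.comp z hd hm⟩
  mono := by
    rcases hf.mono with m | m <;> rcases hh.mono with n | n
    · exact .inl (m.comp n hm)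
    · exact .inr (m.comp_strictAntiOn n hm)
    · exact .inr (m.comp_strictMonoOn n hm)
    · exact .inl (m.comp n hm)
  cross x y z w h1 h2 h3 h4 h5 := by
    have hx : x ∈ Icc a b := ⟨by linarith, by linarith⟩
    have hy : y ∈ Icc a b := ⟨by linarith, by linarith⟩
    have hz : z ∈ Icc a b := ⟨by linarith, by linarith⟩
    have hw : w ∈ Icc a b := ⟨by linarith, by linarith⟩
    have key := hh.cross x y z w h1 h2 h3 h4 h5
    have key2 : |h z - h y| * |h w - h x| * (|f (h y) - f (h x)| * |f (h w) - f (h z)|) ≤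
      |f (h z) - f (h y)| * |f (h w) - f (h x)| * (|h y - h x| * |h w - h z|) := by
      rcases hh.mono with m | m
      · have i1 := m hx hy h2
        have i2 := m hy hz h3
        have i3 := m hz hw h4
        rw [abs_of_pos (sub_pos.2 i2), abs_of_pos (sub_pos.2 i1), abs_of_pos (sub_pos.2 i3),
          abs_of_pos (sub_pos.2 (i1.trans (i2.trans i3)))]
        exact hf.cross _ _ _ _ (hm hx).1 i1 i2 i3 (hm hw).2
      · exact hf.cross_rev (hm hx).2 (m hx hy h2) (m hy hz h3) (m hz hw h4) (hm hw).1
    have ne : ∀ {s t}, s ∈ Icc a b → t ∈ Icc a b → s < t → 0 < |h t - h s| := fun hs ht hl =>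
      abs_pos.2 (sub_ne_zero.2 fun e => hl.ne' (hh.injOn ht hs e))
    have p1 := ne hy hz h3
    have p2 := ne hx hw (by linarith)
    have p3 := ne hx hy h2
    have p4 := ne hz hw h4
    simp only [Function.comp_apply]
    generalize |h z - h y| = A at *
    generalize |h w - h x| = B at *
    generalize |h y - h x| = C at *
    generalize |h w - h z| = D at *
    have n1 : 0 ≤ |f (h y) - f (h x)| * |f (h w) - f (h z)| := by positivity
    have n2 : 0 ≤ (y - x) * (w - z) :=
      mul_nonneg (by linarith) (by linarith)
    generalize |f (h y) - f (h x)| * |f (h w) - f (h z)| = M at *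
    generalize |f (h z) - f (h y)| * |f (h w) - f (h x)| = N at *
    generalize (y - x) * (w - z) = M' at *
    generalize (z - y) * (w - x) = N' at *
    have hAB : 0 < A * B := by positivity
    have hCD : 0 < C * D := by positivity
    -- The cross ratio factors multiply along the composition: `A * B` disappears by transitivity
    -- and `C * D` is cancelled.
    have s1 := mul_le_mul_of_nonneg_right key n1
    have s2 := mul_le_mul_of_nonneg_right key2 n2
    have : (C * D) * (N' * M) ≤ (C * D) * (N * M') := by linarith
    exact le_of_mul_le_mul_left this hCD

theorem neg_id (hab : a < b) : CrossExpanding (fun x => -x) a b where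
  lt := hab
  deriv z _ := ⟨-1, by norm_num, (hasDerivAt_neg z).hasDerivWithinAt⟩
  mono := .inr fun x _ y _ hxy => neg_lt_neg hxy
  cross x y z w h1 h2 h3 h4 h5 := by
    simp only [neg_sub_neg]
    rw [abs_sub_comm x y, abs_sub_comm z w, abs_sub_comm y z, abs_sub_comm x w,
      abs_of_pos (sub_pos.2 h2), abs_of_pos (sub_pos.2 h4), abs_of_pos (sub_pos.2 h3),
      abs_of_pos (sub_pos.2 (h2.trans (h3.trans h4)))]

theorem id (hab : a < b) : CrossExpanding (fun x => x) a b := by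
  have := (neg_id (a := -b) (b := -a) (by linarith)).comp (neg_id hab)
    (fun x hx => ⟨neg_le_neg hx.2, neg_le_neg hx.1⟩)
  exact this.congr fun x _ => (neg_neg x).symm

theorem reflect (hf : CrossExpanding f a b) : CrossExpanding (fun x => f (-x)) (-b) (-a) :=
  hf.comp (neg_id (neg_lt_neg hf.lt)) fun x hx => ⟨by linarith [hx.2], by linarith [hx.1]⟩

theorem sq_right (c : ℝ) (h1 : c < a) (h2 : a < b) : CrossExpanding (fun x => (x - c) ^ 2) a b where
  lt := h2
  deriv z hz := by
    refine ⟨2 * (z - c), by have := hz.1; intro h; linarith, ?_⟩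
    have := ((hasDerivAt_id z).sub_const c).fun_pow 2
    exact (this.congr_deriv (by simp)).hasDerivWithinAt
  mono := .inl fun x hx y hy hxy => by
    have := hx.1
    have : 0 < (y - x) * ((y - c) + (x - c)) := mul_pos (by linarith) (by linarith)
    show (x - c) ^ 2 < (y - c) ^ 2
    nlinarith
  cross x y z w g1 g2 g3 g4 g5 := by
    have e : ∀ s t, a ≤ s → s < t →
        |(t - c) ^ 2 - (s - c) ^ 2| = (t - s) * ((t - c) + (s - c)) := fun s t i j => by
      rw [abs_of_nonneg]
      · ring
      · have : 0 ≤ (t - s) * ((t - c) + (s - c)) := mul_nonneg (by linarith) (by linarith)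
        nlinarith
    rw [e x y g1 g2, e z w (by linarith) g4, e y z (by linarith) g3, e x w g1 (by linarith)]
    -- This product is exactly the difference of the two sides, since `(Z + Y)(W + X) - (Y + X)(W +
    -- Z) = (Z - X)(W - Y)` for the coordinates measured from `c`.
    have : 0 ≤ (z - y) * (w - x) * ((y - x) * (w - z)) * ((z - x) * (w - y)) := by
      have := sub_pos.2 g2; have := sub_pos.2 g3; have := sub_pos.2 g4
      have : 0 < w - x := by linarith
      have : 0 < z - x := by linarith
      have : 0 < w - y := by linarith
      positivity
    nlinarith

theorem sq_left (c : ℝ) (h1 : b < c) (h2 : a < b) :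
    CrossExpanding (fun x => (x - c) ^ 2) a b := by
  have := (sq_right (-c) (neg_lt_neg h1) (neg_lt_neg h2)).reflect
  rw [neg_neg, neg_neg] at this
  exact this.congr fun x _ => by simp only; ring

/-- Preimage of an interval. -/
theorem preimage (hf : CrossExpanding f a b) {A B α β : ℝ} (him : f '' Icc a b = Icc A B)
    (hα : A ≤ α) (hαβ : α < β) (hβ : β ≤ B) :
    ∃ p q, a ≤ p ∧ p < q ∧ q ≤ b ∧ f '' Icc p q = Icc α β ∧
      (∀ z ∈ Icc a b, f z ∈ Icc α β ↔ z ∈ Icc p q) ∧ (A < α → β < B → a < p ∧ q < b) := by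
  obtain ⟨s, hs, hsα⟩ : α ∈ f '' Icc a b := him ▸ ⟨hα, by linarith⟩
  obtain ⟨t, ht, htβ⟩ : β ∈ f '' Icc a b := him ▸ ⟨by linarith, hβ⟩
  have hAl : ∀ z ∈ Icc a b, A ≤ f z ∧ f z ≤ B := fun z hz => by
    have : f z ∈ Icc A B := him ▸ mem_image_of_mem f hz
    exact this
  obtain ⟨s₀, hs₀, hsA⟩ : A ∈ f '' Icc a b := him ▸ ⟨le_rfl, by linarith⟩
  obtain ⟨t₀, ht₀, htB⟩ : B ∈ f '' Icc a b := him ▸ ⟨by linarith, le_rfl⟩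
  have fin : ∀ p q, a ≤ p → p < q → q ≤ b → (∀ z ∈ Icc a b, f z ∈ Icc α β ↔ z ∈ Icc p q) →
      f '' Icc p q = Icc α β := fun p q h1 h2 h3 h4 => by
    ext u
    constructor
    · rintro ⟨z, hz, rfl⟩
      exact (h4 z ⟨h1.trans hz.1, hz.2.trans h3⟩).2 hz
    · intro hu
      obtain ⟨z, hz, rfl⟩ : u ∈ f '' Icc a b := him ▸ ⟨hα.trans hu.1, hu.2.trans hβ⟩
      exact ⟨z, (h4 z hz).1 hu, rfl⟩
  rcases hf.mono with m | m
  · have hst : s < t := (m.lt_iff_lt hs ht).1 (by rw [hsα, htβ]; exact hαβ)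
    have h4 : ∀ z ∈ Icc a b, f z ∈ Icc α β ↔ z ∈ Icc s t := fun z hz => by
      rw [mem_Icc, ← hsα, ← htβ, m.le_iff_le hs hz, m.le_iff_le hz ht, mem_Icc]
    refine ⟨s, t, hs.1, hst, ht.2, fin s t hs.1 hst ht.2 h4, h4, fun i j => ⟨?_, ?_⟩⟩
    · exact lt_of_le_of_lt hs₀.1 ((m.lt_iff_lt hs₀ hs).1 (by linarith))
    · exact lt_of_lt_of_le ((m.lt_iff_lt ht ht₀).1 (by linarith)) ht₀.2
  · have hst : t < s := (m.lt_iff_gt hs ht).1 (by rw [hsα, htβ]; exact hαβ)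
    have h4 : ∀ z ∈ Icc a b, f z ∈ Icc α β ↔ z ∈ Icc t s := fun z hz => by
      rw [mem_Icc, ← hsα, ← htβ, m.le_iff_ge hs hz, m.le_iff_ge hz ht, mem_Icc, and_comm]
    refine ⟨t, s, ht.1, hst, hs.2, fin t s ht.1 hst hs.2 h4, h4, fun i j => ⟨?_, ?_⟩⟩
    · exact lt_of_le_of_lt ht₀.1 ((m.lt_iff_gt ht ht₀).1 (by linarith))
    · exact lt_of_lt_of_le ((m.lt_iff_gt hs₀ hs).1 (by linarith)) hs₀.2

theorem image_endpoints (hf : CrossExpanding f a b) {A B : ℝ} (him : f '' Icc a b = Icc A B) :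
    (f a = A ∧ f b = B) ∨ (f a = B ∧ f b = A) := by
  have ha : a ∈ Icc a b := ⟨le_rfl, hf.lt.le⟩
  have hb : b ∈ Icc a b := ⟨hf.lt.le, le_rfl⟩
  have hAl : ∀ z ∈ Icc a b, f z ∈ Icc A B := fun z hz => him ▸ mem_image_of_mem f hz
  have hAB : A ≤ B := (hAl a ha).1.trans (hAl a ha).2
  obtain ⟨s₀, hs₀, hsA⟩ : A ∈ f '' Icc a b := him ▸ ⟨le_rfl, hAB⟩
  obtain ⟨t₀, ht₀, htB⟩ : B ∈ f '' Icc a b := him ▸ ⟨hAB, le_rfl⟩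
  rcases hf.mono with m | m
  · exact .inl ⟨le_antisymm (hsA ▸ (m.le_iff_le ha hs₀).2 hs₀.1) (hAl a ha).1,
      le_antisymm (hAl b hb).2 (htB ▸ (m.le_iff_le ht₀ hb).2 ht₀.2)⟩
  · exact .inr ⟨le_antisymm (hAl a ha).2 (htB ▸ (m.le_iff_ge ht₀ ha).2 ht₀.1),
      le_antisymm (hsA ▸ (m.le_iff_ge hb hs₀).2 hs₀.2) (hAl b hb).1⟩

/-- Koebe principle on one side. -/
theorem koebe_right (hf : CrossExpanding f a b) {x y d e : ℝ} (hx : a ≤ x) (hxy : x < y)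
    (hy : y < b) (hd : HasDerivWithinAt f d (Icc a b) x) (he : HasDerivWithinAt f e (Icc a b) y) :
    |d| * |f b - f y| ^ 2 ≤ |e| * |f b - f x| ^ 2 := by
  have hab := hf.lt
  have slope_lim : ∀ {s d}, a ≤ s → s < b → HasDerivWithinAt f d (Icc a b) s →
      Tendsto (fun t => |f t - f s| / (t - s)) (𝓝[>] s) (𝓝 |d|) := fun {s d} h1 h2 h => by
    have h' : HasDerivWithinAt f d (Ioi s) s := by
      refine h.mono_of_mem_nhdsWithin ?_
      refine mem_of_superset (Ioo_mem_nhdsGT h2) fun t ht => ⟨h1.trans ht.1.le, ht.2.le⟩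
    have := (hasDerivWithinAt_iff_tendsto_slope' (self_notMem_Ioi)).1 h'
    refine this.abs.congr' ?_
    filter_upwards [self_mem_nhdsWithin] with t ht
    rw [slope_def_field, abs_div, abs_of_pos (sub_pos.2 (show s < t from ht))]
  have cont : ∀ {s}, a ≤ s → s < b → Tendsto f (𝓝[>] s) (𝓝 (f s)) := fun {s} h1 h2 => by
    have := hf.continuousOn s ⟨h1, h2.le⟩
    refine this.mono_left ?_
    rw [← nhdsWithin_Ioo_eq_nhdsGT h2]
    exact nhdsWithin_mono _ fun t ht => ⟨h1.trans ht.1.le, ht.2.le⟩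
  have idt : ∀ s : ℝ, Tendsto (fun t : ℝ => t) (𝓝[>] s) (𝓝 s) := fun s =>
    tendsto_id.mono_left nhdsWithin_le_nhds
  -- Cross ratio inequality for `x < y < t < b`, divided by `t - y`, as `t ↓ y`.
  have L1 : (b - x) * (|f y - f x| * |f b - f y|) ≤ |e| * |f b - f x| * ((y - x) * (b - y)) := by
    have l1 : Tendsto (fun t => (b - x) * (|f y - f x| * |f b - f t|)) (𝓝[>] y)
        (𝓝 ((b - x) * (|f y - f x| * |f b - f y|))) :=
      ((((cont (by linarith) hy).const_sub (f b)).abs).const_mul _).const_mul _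
    have l2 : Tendsto (fun t => |f t - f y| / (t - y) * |f b - f x| * ((y - x) * (b - t))) (𝓝[>] y)
        (𝓝 (|e| * |f b - f x| * ((y - x) * (b - y)))) :=
      ((slope_lim (by linarith) hy he).mul_const _).mul (((idt y).const_sub b).const_mul _)
    refine le_of_tendsto_of_tendsto l1 l2 ?_
    filter_upwards [Ioo_mem_nhdsGT hy] with t ht
    have := hf.cross x y t b hx hxy ht.1 ht.2 le_rfl
    have ht0 : 0 < t - y := sub_pos.2 ht.1
    rw [div_mul_eq_mul_div, div_mul_eq_mul_div, le_div_iff₀ ht0]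
    linarith
  -- Cross ratio inequality for `x < t < y < b`, divided by `t - x`, as `t ↓ x`.
  have L2 : (y - x) * (b - x) * (|d| * |f b - f y|) ≤ |f y - f x| * |f b - f x| * (b - y) := by
    have hxb : x < b := by linarith
    have l1 : Tendsto (fun t => (y - t) * (b - x) * (|f t - f x| / (t - x) * |f b - f y|)) (𝓝[>] x)
        (𝓝 ((y - x) * (b - x) * (|d| * |f b - f y|))) :=
      (((idt x).const_sub y).mul_const _).mul ((slope_lim hx hxb hd).mul_const _)
    have l2 : Tendsto (fun t => |f y - f t| * |f b - f x| * (b - y)) (𝓝[>] x)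
        (𝓝 (|f y - f x| * |f b - f x| * (b - y))) :=
      ((((cont hx hxb).const_sub (f y)).abs).mul_const _).mul_const _
    refine le_of_tendsto_of_tendsto l1 l2 ?_
    filter_upwards [Ioo_mem_nhdsGT hxy] with t ht
    have := hf.cross x t y b hx ht.1 ht.2 hy le_rfl
    have ht0 : 0 < t - x := sub_pos.2 ht.1
    rw [div_mul_eq_mul_div, ← mul_div_assoc, div_le_iff₀ ht0]
    linarith
  have hfne : ∀ {s t}, s ∈ Icc a b → t ∈ Icc a b → s < t → 0 < |f t - f s| := fun hs ht hl =>
      abs_pos.2 (sub_ne_zero.2 fun e => hl.ne' (hf.injOn ht hs e))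
  have p1 := hfne (s := x) (t := y) ⟨hx, by linarith⟩ ⟨by linarith, hy.le⟩ hxy
  have p2 := hfne (s := x) (t := b) ⟨hx, by linarith⟩ ⟨by linarith, le_rfl⟩ (by linarith)
  have p3 := hfne (s := y) (t := b) ⟨by linarith, hy.le⟩ ⟨by linarith, le_rfl⟩ (by linarith)
  generalize |f y - f x| = X at *
  generalize |f b - f x| = Y at *
  generalize |f b - f y| = Z at *
  have hn : 0 ≤ |d| := abs_nonneg d
  generalize |d| = d at *
  generalize |e| = e at *
  have u1 : 0 < y - x := by linarith
  have u2 : 0 < b - y := by linarith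
  have u3 : b - y ≤ b - x := by linarith
  have u4 : 0 < b - x := by linarith
  generalize y - x = u at *
  generalize b - y = v at *
  generalize b - x = w at *
  -- combine the two bounds
  have s1 : (w * (X * Z)) * (u * w * (d * Z)) ≤ (e * Y * (u * v)) * (X * Y * v) :=
    mul_le_mul L1 L2 (by positivity) ((by positivity : 0 ≤ w * (X * Z)).trans L1)
  have s2 : (X * u) * (w ^ 2 * (d * Z ^ 2)) ≤ (X * u) * (v ^ 2 * (e * Y ^ 2)) := by linarith
  have s3 := le_of_mul_le_mul_left s2 (by positivity)
  -- The product of the two bounds is sharper by the factor `((b - y) / (b - x))² ≤ 1`, which is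
  -- given away.
  have s4 : v ^ 2 * (d * Z ^ 2) ≤ w ^ 2 * (d * Z ^ 2) :=
    mul_le_mul_of_nonneg_right (by gcongr) (by positivity)
  exact le_of_mul_le_mul_left (s4.trans s3) (by positivity)

theorem koebe_left (hf : CrossExpanding f a b) {x y d e : ℝ} (hx : a < x) (hxy : x < y)
    (hy : y ≤ b) (hd : HasDerivWithinAt f d (Icc a b) x) (he : HasDerivWithinAt f e (Icc a b) y) :
    |e| * |f a - f x| ^ 2 ≤ |d| * |f a - f y| ^ 2 := by
  have key : ∀ {s d}, HasDerivWithinAt f d (Icc a b) s →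
      HasDerivWithinAt (fun x => f (-x)) (-d) (Icc (-b) (-a)) (-s) := fun {s d} h => by
    have h' : HasDerivWithinAt f d (Icc a b) (- -s) := by rwa [neg_neg]
    have := h'.comp (-s) (hasDerivAt_neg (-s)).hasDerivWithinAt (s := Icc (-b) (-a))
      fun x hx => ⟨by linarith [hx.2], by linarith [hx.1]⟩
    exact this.congr_deriv (by simp)
  have := hf.reflect.koebe_right (neg_le_neg hy) (neg_lt_neg hxy) (neg_lt_neg hx) (key he) (key hd)
  simpa using this

end CrossExpanding

/-! ### Negative Schwarzian derivative implies expansion of cross ratios -/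

section Schwarzian

variable {f f₁ f₂ f₃ : ℝ → ℝ} {a b : ℝ}

/-- With `v = 1 / √f'`, both `v` and `u = (f - f x) v` solve `u'' = -½ (Sf) u`. As `Sf < 0` and `f ≥
f x` to the right of `x`, `u` is convex there and lies above its tangent at `x`, whose slope is
`√(f' x)`. Squaring `u y ≥ √(f' x) (y - x)` gives the claim. -/
theorem two_point_inequality (h1 : ∀ x ∈ Ioo a b, HasDerivAt f (f₁ x) x)
    (h2 : ∀ x ∈ Ioo a b, HasDerivAt f₁ (f₂ x) x) (h3 : ∀ x ∈ Ioo a b, HasDerivAt f₂ (f₃ x) x)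
    (hpos : ∀ x ∈ Ioo a b, 0 < f₁ x)
    (hneg : ∀ x ∈ Ioo a b, f₃ x / f₁ x - 3 / 2 * (f₂ x / f₁ x) ^ 2 < 0)
    {x y : ℝ} (hx : a < x) (hxy : x < y) (hy : y < b) :
    (y - x) ^ 2 * (f₁ x * f₁ y) ≤ (f y - f x) ^ 2 := by
  have mem : ∀ t ∈ Icc x y, t ∈ Ioo a b := fun t ht => ⟨hx.trans_le ht.1, ht.2.trans_lt hy⟩
  set v : ℝ → ℝ := fun t => (√(f₁ t))⁻¹ with hv
  have vpos : ∀ t ∈ Icc x y, 0 < v t := fun t ht =>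
    inv_pos.2 (Real.sqrt_pos.2 (hpos t (mem t ht)))
  have hv2 : ∀ t ∈ Icc x y, f₁ t * v t ^ 2 = 1 := fun t ht => by
    have := hpos t (mem t ht)
    rw [hv]; simp only [inv_pow]
    rw [Real.sq_sqrt this.le, mul_inv_cancel₀ this.ne']
  have hvd : ∀ t ∈ Icc x y, HasDerivAt v (-(f₂ t * v t ^ 3 / 2)) t := fun t ht => by
    have hp := hpos t (mem t ht)
    have := ((h2 t (mem t ht)).sqrt hp.ne').inv (Real.sqrt_pos.2 hp).ne'
    refine this.congr_deriv ?_
    have hs := Real.sqrt_pos.2 hp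
    simp only [hv]
    field_simp
  have mono : ∀ t ∈ Icc x y, f x ≤ f t := by
    have : MonotoneOn f (Icc x y) := monotoneOn_of_deriv_nonneg (convex_Icc x y)
      (fun t ht => (h1 t (mem t ht)).continuousAt.continuousWithinAt)
      (fun t ht => (h1 t (mem t (interior_subset ht))).differentiableAt.differentiableWithinAt)
      (fun t ht => by
        rw [(h1 t (mem t (interior_subset ht))).deriv]; exact (hpos t (mem t (interior_subset ht))).le)
    exact fun t ht => this ⟨le_rfl, hxy.le⟩ ht ht.1
  -- the derivative of `(f - f x) / √f'` is monotone
  set k₁ : ℝ → ℝ := fun t => f₁ t * v t + (f t - f x) * (-(f₂ t * v t ^ 3 / 2)) with hk₁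
  have hk₁d : ∀ t ∈ Icc x y, HasDerivAt k₁
      (f₂ t * v t + f₁ t * (-(f₂ t * v t ^ 3 / 2)) + (f₁ t * (-(f₂ t * v t ^ 3 / 2)) + (f t - f x) *
      (-((f₃ t * v t ^ 3 + f₂ t * (3 * v t ^ 2 * (-(f₂ t * v t ^ 3 / 2)))) / 2)))) t := fun t ht => by
    have e1 := (h2 t (mem t ht)).mul (hvd t ht)
    have e2 := ((h3 t (mem t ht)).mul ((hvd t ht).pow 3)).div_const 2
    have e3 := ((h1 t (mem t ht)).sub_const (f x)).mul e2.neg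
    refine (e1.add e3).congr_deriv ?_
    simp
  have k₁mono : MonotoneOn k₁ (Icc x y) := by
    refine monotoneOn_of_deriv_nonneg (convex_Icc x y)
      (fun t ht => (hk₁d t ht).continuousAt.continuousWithinAt)
      (fun t ht => (hk₁d t (interior_subset ht)).differentiableAt.differentiableWithinAt)
      (fun t ht => ?_)
    have ht := interior_subset ht
    rw [(hk₁d t ht).deriv]
    have hp := hpos t (mem t ht)
    have hn := hneg t (mem t ht)
    have e := hv2 t ht
    have hvp := vpos t ht
    have hS : f₃ t * v t ^ 2 - 3 / 2 * (f₂ t * v t ^ 2) ^ 2 ≤ 0 := by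
      have e' : v t ^ 2 = (f₁ t)⁻¹ := by exact eq_inv_of_mul_eq_one_right e
      rw [e', ← div_eq_mul_inv, ← div_eq_mul_inv]; exact hn.le
    have hm : 0 ≤ f t - f x := sub_nonneg.2 (mono t ht)
    have : f₂ t * v t + f₁ t * (-(f₂ t * v t ^ 3 / 2)) + (f₁ t * (-(f₂ t * v t ^ 3 / 2)) +
        (f t - f x) * (-((f₃ t * v t ^ 3 + f₂ t * (3 * v t ^ 2 * (-(f₂ t * v t ^ 3 / 2)))) / 2))) =
        (f t - f x) * v t / 2 * -(f₃ t * v t ^ 2 - 3 / 2 * (f₂ t * v t ^ 2) ^ 2) := by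
      have : f₁ t * (f₂ t * v t ^ 3) = f₂ t * v t * (f₁ t * v t ^ 2) := by ring
      rw [e] at this
      linear_combination -this
    rw [this]
    exact mul_nonneg (by positivity) (by linarith)
  have hxm : x ∈ Icc x y := ⟨le_rfl, hxy.le⟩
  have hym : y ∈ Icc x y := ⟨hxy.le, le_rfl⟩
  have kd : ∀ t ∈ Icc x y, HasDerivAt (fun t => (f t - f x) * v t - f₁ x * v x * (t - x))
      (k₁ t - k₁ x) t := fun t ht => by
    have := (((h1 t (mem t ht)).sub_const (f x)).mul (hvd t ht)).sub
      (((hasDerivAt_id t).sub_const x).const_mul (f₁ x * v x))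
    refine this.congr_deriv ?_
    simp [hk₁]
  have kmono := monotoneOn_of_deriv_nonneg (convex_Icc x y)
      (fun t ht => (kd t ht).continuousAt.continuousWithinAt)
      (fun t ht => (kd t (interior_subset ht)).differentiableAt.differentiableWithinAt)
      (fun t ht => by
        rw [(kd t (interior_subset ht)).deriv]
        exact sub_nonneg.2 (k₁mono hxm (interior_subset ht) (interior_subset ht).1))
  have fin := kmono hxm hym hxy.le
  simp only [sub_self, zero_mul, mul_zero] at fin
  have i1 : f₁ x * v x * (y - x) ≤ (f y - f x) * v y := by linarith
  have i0 : 0 ≤ f₁ x * v x * (y - x) :=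
    mul_nonneg (mul_nonneg (hpos x (mem x hxm)).le (vpos x hxm).le) (by linarith)
  have i2 := pow_le_pow_left₀ i0 i1 2
  have e1 := hv2 x hxm
  have e2 := hv2 y hym
  have i3 := mul_le_mul_of_nonneg_right i2 (hpos y (mem y hym)).le
  calc (y - x) ^ 2 * (f₁ x * f₁ y) = (f₁ x * v x * (y - x)) ^ 2 * f₁ y := by
        linear_combination (-(y - x) ^ 2 * f₁ x * f₁ y) * e1
    _ ≤ ((f y - f x) * v y) ^ 2 * f₁ y := i3
    _ = (f y - f x) ^ 2 := by linear_combination (f y - f x) ^ 2 * e2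

/-- The two-point inequality says that the mixed derivative `∂ₛ∂ₜ log ((f t - f s) / (t - s))` is
nonpositive; integrating it over `s ∈ [x, y]`, `t ∈ [z, w]` gives an inequality of cross ratios. -/
theorem cross_of_schwarzian_neg (hc : ContinuousOn f (Icc a b))
    (h1 : ∀ x ∈ Ioo a b, HasDerivAt f (f₁ x) x)
    (h2 : ∀ x ∈ Ioo a b, HasDerivAt f₁ (f₂ x) x) (h3 : ∀ x ∈ Ioo a b, HasDerivAt f₂ (f₃ x) x)
    (hpos : ∀ x ∈ Ioo a b, 0 < f₁ x)
    (hneg : ∀ x ∈ Ioo a b, f₃ x / f₁ x - 3 / 2 * (f₂ x / f₁ x) ^ 2 < 0)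
    {x y z w : ℝ} (hx : a ≤ x) (hxy : x < y) (hyz : y < z) (hzw : z < w) (hw : w ≤ b) :
    (z - y) * (w - x) * ((f y - f x) * (f w - f z)) ≤
      (f z - f y) * (f w - f x) * ((y - x) * (w - z)) := by
  have mono : StrictMonoOn f (Icc a b) := by
    refine strictMonoOn_of_deriv_pos (convex_Icc a b) hc fun t ht => ?_
    rw [interior_Icc] at ht
    rw [(h1 t ht).deriv]; exact hpos t ht
  -- The integration in `t`; the one in `s` is the monotonicity `anti` further down.
  have step1 : ∀ s ∈ Ioo x y, 1 / (w - s) - f₁ s / (f w - f s) ≤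
      1 / (z - s) - f₁ s / (f z - f s) := fun s hs => by
    have hsm : s ∈ Ioo a b := ⟨by linarith [hs.1], by linarith [hs.2]⟩
    have hlt : ∀ t ∈ Icc z w, 0 < t - s ∧ 0 < f t - f s := fun t ht =>
      ⟨by linarith [ht.1, hs.2], sub_pos.2 (mono ⟨hsm.1.le, hsm.2.le⟩
        ⟨by linarith [ht.1, hsm.1], ht.2.trans hw⟩ (by linarith [ht.1, hs.2]))⟩
    have hd : ∀ t ∈ Ioo z w, HasDerivAt (fun t => 1 / (t - s) - f₁ s / (f t - f s))
        (-1 / (t - s) ^ 2 + f₁ s * f₁ t / (f t - f s) ^ 2) t := fun t ht => by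
      have htm : t ∈ Ioo a b := ⟨by linarith [hsm.1, hs.2, ht.1], by linarith [ht.2]⟩
      obtain ⟨q1, q2⟩ := hlt t ⟨ht.1.le, ht.2.le⟩
      have e1 := (hasDerivAt_const t (1 : ℝ)).div ((hasDerivAt_id t).sub_const s) q1.ne'
      have e2 := (hasDerivAt_const t (f₁ s)).div ((h1 t htm).sub_const (f s)) q2.ne'
      refine (e1.sub e2).congr_deriv ?_
      simp only [_root_.id]
      ring
    have anti : AntitoneOn (fun t => 1 / (t - s) - f₁ s / (f t - f s)) (Icc z w) := by
      refine antitoneOn_of_deriv_nonpos (convex_Icc z w) ?_ ?_ ?_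
      · have hcf : ContinuousOn f (Icc z w) := hc.mono (Icc_subset_Icc (by linarith) hw)
        refine ContinuousOn.sub (ContinuousOn.div continuousOn_const
          (continuousOn_id.sub continuousOn_const) fun t ht => (hlt t ht).1.ne')
          (ContinuousOn.div continuousOn_const (hcf.sub continuousOn_const)
          fun t ht => (hlt t ht).2.ne')
      · rw [interior_Icc]
        exact fun t ht => (hd t ht).differentiableAt.differentiableWithinAt
      · rw [interior_Icc]
        intro t ht
        rw [(hd t ht).deriv]
        obtain ⟨q1, q2⟩ := hlt t ⟨ht.1.le, ht.2.le⟩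
        have := two_point_inequality h1 h2 h3 hpos hneg hsm.1 (sub_pos.1 q1) (by linarith [ht.2])
        have : f₁ s * f₁ t / (f t - f s) ^ 2 ≤ 1 / (t - s) ^ 2 := by
          rw [div_le_div_iff₀ (by positivity) (by positivity)]; linarith
        rw [neg_div]; linarith
    exact anti ⟨le_rfl, hzw.le⟩ ⟨hzw.le, le_rfl⟩ hzw.le
  have hlt : ∀ s ∈ Icc x y, (0 < z - s ∧ 0 < f z - f s) ∧ (0 < w - s ∧ 0 < f w - f s) :=
    fun s hs => by
    have hsm : s ∈ Icc a b := ⟨by linarith [hs.1], by linarith [hs.2]⟩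
    exact ⟨⟨by linarith [hs.2], sub_pos.2 (mono hsm ⟨by linarith, by linarith⟩ (by linarith [hs.2]))⟩,
      ⟨by linarith [hs.2], sub_pos.2 (mono hsm ⟨by linarith, by linarith⟩ (by linarith [hs.2]))⟩⟩
  have hd : ∀ s ∈ Ioo x y, HasDerivAt (fun s => Real.log (f w - f s) - Real.log (w - s)
      - (Real.log (f z - f s) - Real.log (z - s)))
      ((-f₁ s) / (f w - f s) - (-1) / (w - s) - ((-f₁ s) / (f z - f s) - (-1) / (z - s))) s :=
    fun s hs => by
    have hsm : s ∈ Ioo a b := ⟨by linarith [hs.1], by linarith [hs.2]⟩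
    obtain ⟨⟨q1, q2⟩, q3, q4⟩ := hlt s ⟨hs.1.le, hs.2.le⟩
    exact ((((h1 s hsm).const_sub (f w)).log q4.ne').sub
      (((hasDerivAt_id s).const_sub w).log q3.ne')).sub
      ((((h1 s hsm).const_sub (f z)).log q2.ne').sub
      (((hasDerivAt_id s).const_sub z).log q1.ne'))
  have anti : AntitoneOn (fun s => Real.log (f w - f s) - Real.log (w - s)
      - (Real.log (f z - f s) - Real.log (z - s))) (Icc x y) := by
    refine antitoneOn_of_deriv_nonpos (convex_Icc x y) ?_ ?_ ?_
    · have hcf : ContinuousOn f (Icc x y) := hc.mono (Icc_subset_Icc hx (by linarith))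
      exact ((((continuousOn_const.sub hcf).log fun s hs => (hlt s hs).2.2.ne')).sub
        ((continuousOn_const.sub continuousOn_id).log fun s hs => (hlt s hs).2.1.ne')).sub
        (((continuousOn_const.sub hcf).log fun s hs => (hlt s hs).1.2.ne').sub
        ((continuousOn_const.sub continuousOn_id).log fun s hs => (hlt s hs).1.1.ne'))
    · rw [interior_Icc]
      exact fun t ht => (hd t ht).differentiableAt.differentiableWithinAt
    · rw [interior_Icc]
      intro s hs
      rw [(hd s hs).deriv]
      have := step1 s hs
      simp only [neg_div]
      linarith
  have fin := anti ⟨le_rfl, hxy.le⟩ ⟨hxy.le, le_rfl⟩ hxy.le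
  simp only at fin
  obtain ⟨⟨q1, q2⟩, q3, q4⟩ := hlt x ⟨le_rfl, hxy.le⟩
  obtain ⟨⟨r1, r2⟩, r3, r4⟩ := hlt y ⟨hxy.le, le_rfl⟩
  have fin' : Real.log ((f w - f y) * (z - y) * ((w - x) * (f z - f x))) ≤
      Real.log ((f w - f x) * (z - x) * ((w - y) * (f z - f y))) := by
    rw [Real.log_mul (by positivity) (by positivity), Real.log_mul r4.ne' r1.ne',
      Real.log_mul q3.ne' q2.ne', Real.log_mul (by positivity) (by positivity),
      Real.log_mul q4.ne' q1.ne', Real.log_mul r3.ne' r2.ne']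
    linarith
  -- The identity `(z - x)(w - y) = (y - x)(w - z) + (z - y)(w - x)`, used in the domain and in the
  -- image, passes to the cross ratio of the statement.
  have := (Real.log_le_log_iff (by positivity) (by positivity)).1 fin'
  nlinarith

end Schwarzian

theorem CrossExpanding.of_neg {f : ℝ → ℝ} {a b : ℝ} (hf : CrossExpanding (fun x => -f x) a b) :
    CrossExpanding f a b where
  lt := hf.lt
  deriv z hz := by
    obtain ⟨d, h0, hd⟩ := hf.deriv z hz
    exact ⟨-d, neg_ne_zero.2 h0, by simpa only [neg_neg] using hd.fun_neg⟩
  mono := by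
    rcases hf.mono with m | m
    · exact .inr fun x hx y hy h => neg_lt_neg_iff.1 (m hx hy h)
    · exact .inl fun x hx y hy h => neg_lt_neg_iff.1 (m hx hy h)
  cross x y z w h1 h2 h3 h4 h5 := by
    have := hf.cross x y z w h1 h2 h3 h4 h5
    simp only [neg_sub_neg] at this
    rwa [abs_sub_comm (f y), abs_sub_comm (f w) (f z),
    abs_sub_comm (f z) (f y), abs_sub_comm (f w) (f x)]

theorem crossExpanding_of_schwarzian_neg {h : ℝ → ℝ} {a b : ℝ} (hab : a < b)
    (smooth : ContDiffOn ℝ 3 h (Icc a b)) (pos : ∀ z ∈ Icc a b, 0 < derivWithin h (Icc a b) z)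
    (neg : ∀ z ∈ Ioo a b, schwarzian h z < 0) : CrossExpanding h a b := by
  have s0 : ContDiffOn ℝ 3 h (Ioo a b) := smooth.mono Ioo_subset_Icc_self
  have s1 : ContDiffOn ℝ 2 (deriv h) (Ioo a b) := s0.deriv_of_isOpen isOpen_Ioo (by norm_num)
  have s2 : ContDiffOn ℝ 1 (deriv (deriv h)) (Ioo a b) :=
    s1.deriv_of_isOpen isOpen_Ioo (by norm_num)
  have hd : ∀ {n : WithTop ℕ∞} {u : ℝ → ℝ}, n ≠ 0 → ContDiffOn ℝ n u (Ioo a b) →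
      ∀ x ∈ Ioo a b, HasDerivAt u (deriv u x) x := fun hn hu x hx =>
    ((hu.differentiableOn hn).differentiableAt (isOpen_Ioo.mem_nhds hx)).hasDerivAt
  have h1 := hd (by norm_num) s0
  have h2 := hd (by norm_num) s1
  have h3 := hd (by norm_num) s2
  have hpos : ∀ x ∈ Ioo a b, 0 < deriv h x := fun x hx => by
    rw [← derivWithin_of_mem_nhds (Icc_mem_nhds hx.1 hx.2)]
    exact pos x (Ioo_subset_Icc_self hx)
  have mono : StrictMonoOn h (Icc a b) := by
    refine strictMonoOn_of_deriv_pos (convex_Icc a b) smooth.continuousOn fun t ht => ?_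
    rw [interior_Icc] at ht
    exact hpos t ht
  refine ⟨hab, fun z hz => ⟨_, (pos z hz).ne', ?_⟩, .inl mono, ?_⟩
  · exact (differentiableWithinAt_of_derivWithin_ne_zero (pos z hz).ne').hasDerivWithinAt
  · intro x y z w g1 g2 g3 g4 g5
    have := cross_of_schwarzian_neg smooth.continuousOn h1 h2 h3 hpos neg g1 g2 g3 g4 g5
    have hl : ∀ {s t}, s ∈ Icc a b → t ∈ Icc a b → s < t → |h t - h s| = h t - h s :=
      fun hs ht h => abs_of_pos (sub_pos.2 (mono hs ht h))
    have mx : x ∈ Icc a b := ⟨by linarith, by linarith⟩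
    have my : y ∈ Icc a b := ⟨by linarith, by linarith⟩
    have mz : z ∈ Icc a b := ⟨by linarith, by linarith⟩
    have mw : w ∈ Icc a b := ⟨by linarith, by linarith⟩
    rwa [hl mx my g2, hl mz mw g4, hl my mz g3, hl mx mw (by linarith)]

theorem IsNegSchwarzDiffeo.crossExpanding {h : ℝ → ℝ} {A J : Set ℝ}
    (hh : IsNegSchwarzDiffeo h A J) : ∃ a b, A = Icc a b ∧ CrossExpanding h a b ∧
      h '' Icc a b = J := by
  obtain ⟨⟨a, b, hab, rfl⟩, smooth, ne, onto, neg⟩ := hh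
  refine ⟨a, b, rfl, ?_, onto⟩
  rw [interior_Icc] at neg
  -- A nonvanishing derivative has constant sign by Darboux; since `S(-h) = Sh`, the decreasing case
  -- reduces to the increasing one.
  rcases hasDerivWithinAt_forall_lt_or_forall_gt_of_forall_ne (convex_Icc a b)
    (fun x hx => (differentiableWithinAt_of_derivWithin_ne_zero (ne x hx)).hasDerivWithinAt) ne
    with hs | hs
  · refine CrossExpanding.of_neg (crossExpanding_of_schwarzian_neg hab smooth.neg ?_ ?_)
    · intro z hz
      rw [derivWithin.fun_neg]
      exact neg_pos.2 (hs z hz)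
    · intro z hz
      have e : ∀ u : ℝ → ℝ, deriv (fun x => -u x) = fun x => -deriv u x := fun u => by
        ext x; exact deriv.fun_neg
      have := neg z hz
      unfold schwarzian at *
      rw [e, e, e]
      simpa only [neg_div_neg_eq] using this
  · exact crossExpanding_of_schwarzian_neg hab smooth hs neg

namespace TData

/-! ### Maps with cross ratio expanding branches -/

/-- The class of maps to which the estimates apply: the central interval is
`[c - r, c + r]`, the range `[c - R, c + R]`, the domain of the central diffeomorphism `[a, r²]`, and
all branches expand cross ratios. -/
structure IsExpanding (g : TData) (r R a : ℝ) : Prop where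
  r_pos : 0 < r
  r_lt : r < R
  J_eq : g.J = Icc (g.c - R) (g.c + R)
  central_eq : g.central = Icc (g.c - r) (g.c + r)
  central_mem : g.central ∈ g.pieces
  a_nonpos : a ≤ 0
  dom_eq : g.dom g.central = Icc a (r ^ 2)
  expanding_central : CrossExpanding (g.diffeo g.central) a (r ^ 2)
  image_central : g.diffeo g.central '' Icc a (r ^ 2) = g.J
  map_central : ∀ x ∈ g.central, g.map x = g.diffeo g.central (g.phi x)
  subset : ∀ W ∈ g.pieces, W ⊆ g.J
  disj : ∀ U ∈ g.pieces, ∀ V ∈ g.pieces, U ≠ V → Disjoint U V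
  branch : ∀ W ∈ g.pieces, W ≠ g.central → ∃ α β, W = Icc α β ∧ CrossExpanding g.map α β ∧
    g.map '' Icc α β = g.J

/-- The points of `J` whose first `k` iterates lie in the same intervals as those of `y`. -/
def cylinder (g : TData) (k : ℕ) (y : ℝ) : Set ℝ :=
  {u ∈ g.J | ∀ j < k, ∃ W ∈ g.pieces, g.map^[j] y ∈ W ∧ g.map^[j] u ∈ W}

theorem phi_image_symm (g : TData) {r : ℝ} (hr : 0 ≤ r) :
    g.phi '' Icc (g.c - r) (g.c + r) = Icc 0 (r ^ 2) := by
  ext z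
  constructor
  · rintro ⟨x, hx, rfl⟩
    exact ⟨sq_nonneg _, sq_le_sq' (by linarith [hx.1]) (by linarith [hx.2])⟩
  · intro hz
    refine ⟨g.c + √z, ⟨by linarith [Real.sqrt_nonneg z], ?_⟩, ?_⟩
    · have := Real.sqrt_le_sqrt hz.2
      rw [Real.sqrt_sq hr] at this
      linarith
    · simp [phi, Real.sq_sqrt hz.1]

theorem central_eq_of_mem {g : TData} {W : Set ℝ}
    (disj : ∀ U ∈ g.pieces, ∀ V ∈ g.pieces, U ≠ V → Disjoint U V) (hW : W ∈ g.pieces)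
    (hc : g.c ∈ W) : g.central = W := by
  have : {W ∈ g.pieces | g.c ∈ W} = {W} := by
    ext V
    constructor
    · rintro ⟨hV, hcV⟩
      by_contra hne
      exact disjoint_left.1 (disj V hV W hW hne) hcV hc
    · rintro rfl
      exact ⟨hW, hc⟩
  rw [central, this, sUnion_singleton]

/-- A non-central interval lies on one side of `c`, where `φ` is monotone and itself expands cross
ratios, so the whole branch `h ∘ φ` does. On the central interval `φ` folds, and only `h₀` is
recorded as expanding. -/
theorem ClassT.isExpanding {g : TData} (hg : g.ClassT) : ∃ r R a, g.IsExpanding r R a := by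
  obtain ⟨r, R, hr, hrR, hJ, hI⟩ := hg.symm
  have hcen : g.central = Icc (g.c - r) (g.c + r) :=
    central_eq_of_mem hg.disj hI ⟨by linarith, by linarith⟩
  rw [← hcen] at hI
  obtain ⟨a, b, hdom, hexp, him⟩ := (hg.diff _ hI).crossExpanding
  have hphi := g.phi_image_symm hr.le
  obtain ⟨hsub, hhi⟩ := hg.dom_central
  have hsub0 := hsub
  rw [hcen, hphi] at hhi hsub
  rw [← hcen, hdom, hi, hi, csSup_Icc hexp.lt.le, csSup_Icc (by positivity)] at hhi
  subst hhi
  rw [← hcen, hdom] at hsub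
  have ha : a ≤ 0 := (hsub ⟨le_rfl, by positivity⟩).1
  refine ⟨r, R, a, hr, hrR, hJ, hcen, hI, ha, hdom, hexp, him, hg.decomp _ hI, hg.subset, hg.disj,
    fun W hW hne => ?_⟩
  have hcW : g.c ∉ W := fun h => hne (central_eq_of_mem hg.disj hW h).symm
  obtain ⟨α, β, hαβ, rfl⟩ := hg.interval W hW
  obtain ⟨a', b', hdom', hexp', him'⟩ := (hg.diff _ hW).crossExpanding
  have hd := hg.dom_noncentral _ hW hcW
  rw [hdom'] at hd
  have heq : EqOn g.map (g.diffeo (Icc α β) ∘ g.phi) (Icc α β) := hg.decomp _ hW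
  refine ⟨α, β, rfl, ?_, ?_⟩
  · have hsq : CrossExpanding g.phi α β := by
      rcases lt_or_ge g.c α with h | h
      · exact CrossExpanding.sq_right g.c h hαβ
      · refine CrossExpanding.sq_left g.c ?_ hαβ
        by_contra h'
        exact hcW ⟨h, not_lt.1 h'⟩
    exact (hexp'.comp hsq fun x hx => hd ▸ mem_image_of_mem _ hx).congr heq
  · rw [heq.image_eq, image_comp, ← hd, him']

namespace IsExpanding

variable {g : TData} {r R a : ℝ}

theorem eq_of_mem (hg : g.IsExpanding r R a) {U V : Set ℝ} {x : ℝ} (hU : U ∈ g.pieces)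
    (hV : V ∈ g.pieces) (hxU : x ∈ U) (hxV : x ∈ V) : U = V := by
  by_contra h
  exact disjoint_left.1 (hg.disj U hU V hV h) hxU hxV

theorem c_mem (hg : g.IsExpanding r R a) : g.c ∈ g.central := by
  rw [hg.central_eq]; exact ⟨by linarith [hg.r_pos], by linarith [hg.r_pos]⟩

theorem central_subset (hg : g.IsExpanding r R a) : g.central ⊆ g.J := hg.subset _ hg.central_mem

theorem mem_central_iff (hg : g.IsExpanding r R a) {x : ℝ} :
    x ∈ g.central ↔ g.phi x ≤ r ^ 2 := by
  rw [hg.central_eq, phi, sq_le_sq, abs_of_pos hg.r_pos, abs_le, mem_Icc]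
  constructor <;> rintro ⟨h1, h2⟩ <;> constructor <;> linarith

theorem phi_mem_dom (hg : g.IsExpanding r R a) {x : ℝ} (hx : x ∈ g.central) :
    g.phi x ∈ Icc a (r ^ 2) :=
  ⟨hg.a_nonpos.trans (sq_nonneg _), hg.mem_central_iff.1 hx⟩

theorem map_mem_J (hg : g.IsExpanding r R a) {x : ℝ} (hx : x ∈ ⋃₀ g.pieces) : g.map x ∈ g.J := by
  obtain ⟨W, hW, hxW⟩ := hx
  by_cases h : W = g.central
  · subst h
    rw [hg.map_central x hxW, ← hg.image_central]
    exact mem_image_of_mem _ (hg.phi_mem_dom hxW)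
  · obtain ⟨α, β, rfl, -, him⟩ := hg.branch W hW h
    rw [← him]
    exact mem_image_of_mem _ hxW

theorem mem_J_of_pullback (hg : g.IsExpanding r R a) {k : ℕ} {u y : ℝ} (h : u ∈ g.pullback k y) :
    u ∈ g.J := by
  cases k with
  | zero => exact hg.central_subset h.2
  | succ k =>
    obtain ⟨W, hW, -, hu⟩ := h.1 0 k.succ_pos
    exact hg.subset W hW hu

theorem mem_pullback_iff (hg : g.IsExpanding r R a) {k : ℕ} {u y : ℝ} :
    u ∈ g.pullback k y ↔ u ∈ g.cylinder k y ∧ g.map^[k] u ∈ g.central :=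
  ⟨fun h => ⟨⟨hg.mem_J_of_pullback h, h.1⟩, h.2⟩, fun h => ⟨h.1.2, h.2⟩⟩

theorem cylinder_eq (hg : g.IsExpanding r R a) {k : ℕ} {u y : ℝ} (h : u ∈ g.cylinder k y) :
    g.cylinder k u = g.cylinder k y := by
  ext v
  refine and_congr_right fun _ => forall₂_congr fun j hj => ?_
  obtain ⟨W, hW, h1, h2⟩ := h.2 j hj
  constructor
  · rintro ⟨W', hW', h3, h4⟩
    exact ⟨W, hW, h1, hg.eq_of_mem hW' hW h3 h2 ▸ h4⟩
  · rintro ⟨W', hW', h3, h4⟩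
    exact ⟨W, hW, h2, hg.eq_of_mem hW' hW h3 h1 ▸ h4⟩

theorem pullback_eq (hg : g.IsExpanding r R a) {k : ℕ} {u y : ℝ} (h : u ∈ g.cylinder k y) :
    g.pullback k u = g.pullback k y := by
  ext v
  rw [hg.mem_pullback_iff, hg.mem_pullback_iff, hg.cylinder_eq h]

/-- The monotone pull-back of `J` along an orbit which avoids the central interval. -/
theorem exists_cylinder (hg : g.IsExpanding r R a) (k : ℕ) : ∀ y : ℝ,
    (∀ j < k, g.map^[j] y ∈ ⋃₀ g.pieces ∧ g.map^[j] y ∉ g.central) →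
    ∃ α β, g.cylinder k y = Icc α β ∧ CrossExpanding g.map^[k] α β ∧
      g.map^[k] '' Icc α β = g.J := by
  induction k with
  | zero =>
    intro y _
    refine ⟨g.c - R, g.c + R, ?_, ?_, ?_⟩
    · simp [cylinder, ← hg.J_eq]
    · exact CrossExpanding.id (by linarith [hg.r_pos, hg.r_lt])
    · rw [Function.iterate_zero, image_id, hg.J_eq]
  | succ k ih =>
    intro y hy
    obtain ⟨α, β, hcyl, hexp, him⟩ := ih (g.map y) fun j hj => hy (j + 1) (by omega)
    obtain ⟨⟨W, hW, hyW⟩, hnc⟩ := hy 0 k.succ_pos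
    have hne : W ≠ g.central := fun h => hnc (h ▸ hyW)
    obtain ⟨α₀, β₀, rfl, hexp₀, him₀⟩ := hg.branch W hW hne
    have hsub : Icc α β ⊆ g.J := hcyl ▸ fun u hu => hu.1
    rw [hg.J_eq] at hsub him₀
    have hl := hsub ⟨le_rfl, hexp.lt.le⟩
    have hr := hsub ⟨hexp.lt.le, le_rfl⟩
    obtain ⟨p, q, h1, h2, h3, h4, h5, -⟩ := hexp₀.preimage him₀ hl.1 hexp.lt hr.2
    refine ⟨p, q, ?_, ?_, ?_⟩
    · ext u
      have : u ∈ g.cylinder (k + 1) y ↔ u ∈ Icc α₀ β₀ ∧ g.map u ∈ g.cylinder k (g.map y) := by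
        constructor
        · rintro ⟨hu, h⟩
          obtain ⟨W', hW', h6, h7⟩ := h 0 k.succ_pos
          rw [hg.eq_of_mem hW' hW h6 hyW] at h7
          exact ⟨h7, hg.map_mem_J ⟨_, hW, h7⟩, fun j hj => h (j + 1) (by omega)⟩
        · rintro ⟨hu, h⟩
          refine ⟨hg.subset _ hW hu, fun j hj => ?_⟩
          cases j with
          | zero => exact ⟨_, hW, hyW, hu⟩
          | succ j => exact h.2 j (by omega)
      rw [this, hcyl]
      exact ⟨fun h => (h5 u h.1).1 h.2, fun h => have := Icc_subset_Icc h1 h3 h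
        ⟨this, (h5 u this).2 h⟩⟩
    · rw [Function.iterate_succ]
      exact hexp.comp (hexp₀.restrict h1 h2 h3) fun x hx => h4 ▸ mem_image_of_mem _ hx
    · rw [Function.iterate_succ, image_comp, h4, him]

end IsExpanding

/-! ### Branches of the first return map -/

/-- The branch of the first return map through `x`, with return time `k + 1`: the map
`g^k ∘ h₀` maps `[p', q']` onto `J` and `[p, q]` onto `I`. -/
structure IsReturnBranch (g : TData) (r a : ℝ) (k : ℕ) (x p' p q q' : ℝ) : Prop where
  a_le : a ≤ p'
  left_lt : p' < p
  lt : p < q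
  lt_right : q < q'
  le_sq : q' ≤ r ^ 2
  expanding : CrossExpanding (fun z => g.map^[k] (g.diffeo g.central z)) p' q'
  image_J : (fun z => g.map^[k] (g.diffeo g.central z)) '' Icc p' q' = g.J
  image_central : (fun z => g.map^[k] (g.diffeo g.central z)) '' Icc p q = g.central
  mem_cylinder_iff : ∀ z ∈ Icc a (r ^ 2),
    g.diffeo g.central z ∈ g.cylinder k (g.map x) ↔ z ∈ Icc p' q'
  mem_pullback_iff : ∀ z ∈ Icc a (r ^ 2),
    g.diffeo g.central z ∈ g.pullback k (g.map x) ↔ z ∈ Icc p q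
  phi_mem : g.phi x ∈ Icc p q

namespace IsExpanding

variable {g : TData} {r R a : ℝ}

/-- After the first step, which is `h₀ ∘ φ`, the remaining `k` steps run through non-central
intervals, so `g^k` maps a neighbourhood of `g x` monotonically onto all of `J`. Since `I` is
interior to `J`, its pull-back is strictly inside that of `J`. -/
theorem exists_returnBranch (hg : g.IsExpanding r R a) {x : ℝ} {k : ℕ}
    (hx : g.FirstReturn x (k + 1)) : ∃ p' p q q', g.IsReturnBranch r a k x p' p q q' := by
  obtain ⟨hxc, -, hdef, hnc, hret⟩ := hx
  obtain ⟨α, β, hcyl, hexp, him⟩ := hg.exists_cylinder k (g.map x) fun j hj =>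
    ⟨hdef (j + 1) (by omega), hnc (j + 1) (by omega) (by omega)⟩
  have hsub : Icc α β ⊆ g.J := hcyl ▸ fun u hu => hu.1
  have him0 := hg.image_central
  rw [hg.J_eq] at hsub him0
  have hl := hsub ⟨le_rfl, hexp.lt.le⟩
  have hr := hsub ⟨hexp.lt.le, le_rfl⟩
  obtain ⟨p', q', h1, h2, h3, h4, h5, -⟩ := hg.expanding_central.preimage him0 hl.1 hexp.lt hr.2
  have hF : CrossExpanding (fun z => g.map^[k] (g.diffeo g.central z)) p' q' :=
    hexp.comp (hg.expanding_central.restrict h1 h2 h3) fun x hx => h4 ▸ mem_image_of_mem _ hx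
  have hFim : (fun z => g.map^[k] (g.diffeo g.central z)) '' Icc p' q' = g.J := by
    rw [← him, ← h4, image_image]
  have hFim' := hFim
  rw [hg.J_eq] at hFim'
  have hrR := hg.r_lt
  have hr0 := hg.r_pos
  obtain ⟨p, q, k1, k2, k3, k4, k5, k6⟩ := hF.preimage (α := g.c - r) (β := g.c + r) hFim'
    (by linarith) (by linarith) (by linarith)
  obtain ⟨k6, k7⟩ := k6 (by linarith) (by linarith)
  have hpb : ∀ z ∈ Icc a (r ^ 2),
      (g.diffeo g.central z ∈ g.pullback k (g.map x) ↔ z ∈ Icc p q) := fun z hz => by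
    rw [hg.mem_pullback_iff, hcyl, h5 z hz]
    exact ⟨fun h => (k5 z h.1).1 (hg.central_eq.subset h.2), fun h => have := Icc_subset_Icc k1 k3 h
      ⟨this, hg.central_eq.superset ((k5 z this).2 h)⟩⟩
  refine ⟨p', p, q, q', h1, k6, k2, k7, h3, hF, hFim, by rw [k4, hg.central_eq],
    fun z hz => by rw [hcyl, h5 z hz], hpb, ?_⟩
  rw [← hpb _ (hg.phi_mem_dom hxc), ← hg.map_central x hxc]
  refine ⟨fun j hj => ?_, hret⟩
  obtain ⟨W, hW, h⟩ := hdef (j + 1) (by omega)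
  exact ⟨W, hW, h, h⟩

theorem firstReturn_unique {x : ℝ} {k l : ℕ} (hk : g.FirstReturn x k) (hl : g.FirstReturn x l) :
    k = l := by
  rcases lt_trichotomy k l with h | h | h
  · exact absurd hk.2.2.2.2 (hl.2.2.2.1 k hk.2.1 h)
  · exact h
  · exact absurd hl.2.2.2.2 (hk.2.2.2.1 l hl.2.1 h)

theorem returnTime_eq {x : ℝ} {k : ℕ} (hk : g.FirstReturn x k) : g.returnTime x = k := by
  have : {k | g.FirstReturn x k} = {k} := by
    ext l
    exact ⟨fun h => firstReturn_unique h hk, fun h => h ▸ hk⟩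
  rw [returnTime, this, csInf_singleton]

theorem self_mem_pullback {x : ℝ} {k : ℕ} (hx : g.FirstReturn x k) : x ∈ g.pullback k x := by
  refine ⟨fun j hj => ?_, hx.2.2.2.2⟩
  obtain ⟨W, hW, h⟩ := hx.2.2.1 j hj
  exact ⟨W, hW, h, h⟩

theorem mem_pullback_succ (hg : g.IsExpanding r R a) {x : ℝ} {k : ℕ}
    (hx : x ∈ g.central) {u : ℝ} : u ∈ g.pullback (k + 1) x ↔
      u ∈ g.central ∧ g.map u ∈ g.pullback k (g.map x) := by
  constructor
  · rintro ⟨h, h'⟩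
    obtain ⟨W, hW, h1, h2⟩ := h 0 k.succ_pos
    rw [hg.eq_of_mem hW hg.central_mem h1 hx] at h2
    exact ⟨h2, fun j hj => h (j + 1) (by omega), h'⟩
  · rintro ⟨hu, h, h'⟩
    refine ⟨fun j hj => ?_, h'⟩
    cases j with
    | zero => exact ⟨_, hg.central_mem, hx, hu⟩
    | succ j => exact h j (by omega)

theorem pullback_succ_eq (hg : g.IsExpanding r R a) {x : ℝ} {k : ℕ}
    (hx : g.FirstReturn x (k + 1)) {p' p q q' : ℝ} (hb : g.IsReturnBranch r a k x p' p q q') :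
    g.pullback (k + 1) x = {u | (u - g.c) ^ 2 ∈ Icc p q} := by
  ext u
  rw [hg.mem_pullback_succ hx.1]
  constructor
  · rintro ⟨h1, h2⟩
    rw [hg.map_central u h1] at h2
    exact (hb.mem_pullback_iff _ (hg.phi_mem_dom h1)).1 h2
  · intro h
    have hu : u ∈ g.central := hg.mem_central_iff.2 (h.2.trans (hb.lt_right.le.trans hb.le_sq))
    refine ⟨hu, ?_⟩
    rw [hg.map_central u hu]
    exact (hb.mem_pullback_iff _ (hg.phi_mem_dom hu)).2 h

theorem firstReturn_of_mem (hg : g.IsExpanding r R a) {x u : ℝ} {k : ℕ}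
    (hx : g.FirstReturn x (k + 1)) (hu : u ∈ g.pullback (k + 1) x) :
    g.FirstReturn u (k + 1) := by
  refine ⟨((hg.mem_pullback_succ hx.1).1 hu).1, k.succ_pos, fun j hj => ?_, fun j h0 hj h => ?_,
    hu.2⟩
  · obtain ⟨W, hW, -, h⟩ := hu.1 j hj
    exact ⟨W, hW, h⟩
  · obtain ⟨W, hW, h1, h2⟩ := hu.1 j hj
    rw [hg.eq_of_mem hW hg.central_mem h2 h] at h1
    exact hx.2.2.2.1 j h0 hj h1

theorem map_mem_cylinder (hg : g.IsExpanding r R a) {x u : ℝ} {k : ℕ}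
    (hx : g.FirstReturn x (k + 1)) (hu : u ∈ g.pullback (k + 1) x) :
    g.map u ∈ g.cylinder k (g.map x) :=
  (hg.mem_pullback_iff.1 ((hg.mem_pullback_succ hx.1).1 hu).2).1

theorem pullback_succ_congr (hg : g.IsExpanding r R a) {x u : ℝ} {k : ℕ}
    (hx : g.FirstReturn x (k + 1)) (hu : u ∈ g.pullback (k + 1) x) :
    g.pullback (k + 1) u = g.pullback (k + 1) x := by
  ext v
  rw [hg.mem_pullback_succ hx.1, hg.mem_pullback_succ (hg.firstReturn_of_mem hx hu).1,
    hg.pullback_eq (hg.map_mem_cylinder hx hu)]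

/-- A pull-back of `I` is disjoint from the pull-back of `J` along an orbit with no smaller return
time, unless the two branches agree. -/
theorem eq_of_mem_cylinder (hg : g.IsExpanding r R a) {x x' u : ℝ} {k k' : ℕ}
    (hx : g.FirstReturn x (k + 1)) (hk : k' ≤ k)
    (hu : u ∈ g.cylinder k (g.map x)) (hu' : u ∈ g.pullback k' (g.map x')) :
    k' = k ∧ g.pullback k (g.map x) = g.pullback k' (g.map x') := by
  -- If `k' < k`, then `g^k' u ∈ I` and the cylinder would put `g^(k'+1) x` in `I` before its return
  -- time `k + 1`.
  have hkk : k' = k := by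
    by_contra hne
    obtain ⟨W, hW, h1, h2⟩ := hu.2 k' (lt_of_le_of_ne hk hne)
    rw [hg.eq_of_mem hW hg.central_mem h2 hu'.2] at h1
    exact hx.2.2.2.1 (k' + 1) k'.succ_pos (by omega) h1
  subst hkk
  exact ⟨rfl, by rw [← hg.pullback_eq hu, ← hg.pullback_eq (hg.mem_pullback_iff.1 hu').1]⟩

/-- An interval of the new level is determined by any of its points, through the return time of that
point; disjointness of the family follows. -/
theorem exists_of_mem_piece (hg : g.IsExpanding r R a) {W : Set ℝ} (hW : W ∈ g.prerenorm.pieces)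
    {u : ℝ} (hu : u ∈ W) : ∃ k, g.FirstReturn u (k + 1) ∧ W = g.component (k + 1) u := by
  obtain ⟨⟨x, k, hx, rfl⟩, -⟩ := hW
  obtain ⟨k, rfl⟩ : ∃ l, k = l + 1 := ⟨k - 1, by have := hx.2.1; omega⟩
  have hup : u ∈ g.pullback (k + 1) x := ordConnectedComponent_subset hu
  refine ⟨k, hg.firstReturn_of_mem hx hup, ?_⟩
  rw [component, component, hg.pullback_succ_congr hx hup]
  exact ordConnectedComponent_eq hu

theorem piece_nonempty {W : Set ℝ} (hW : W ∈ g.prerenorm.pieces) : W.Nonempty := by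
  obtain ⟨-, h⟩ := hW
  exact h.left

end IsExpanding

/-! ### Components of preimages under the quadratic map -/

theorem ordConnectedComponent_sq {c p q x : ℝ} (hx : (x - c) ^ 2 ∈ Icc p q) :
    (p ≤ 0 ∧ ordConnectedComponent {u | (u - c) ^ 2 ∈ Icc p q} x = Icc (c - √q) (c + √q)) ∨
    (0 < p ∧ (ordConnectedComponent {u | (u - c) ^ 2 ∈ Icc p q} x = Icc (c + √p) (c + √q) ∨
      ordConnectedComponent {u | (u - c) ^ 2 ∈ Icc p q} x = Icc (c - √q) (c - √p))) := by
  have hq : 0 ≤ q := (sq_nonneg _).trans hx.2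
  have sqle : ∀ u : ℝ, (u - c) ^ 2 ≤ q ↔ c - √q ≤ u ∧ u ≤ c + √q := fun u => by
    rw [← Real.sqrt_le_sqrt_iff hq, Real.sqrt_sq_eq_abs, abs_le]
    constructor <;> rintro ⟨h1, h2⟩ <;> constructor <;> linarith
  rcases le_or_gt p 0 with hp | hp
  · refine .inl ⟨hp, ?_⟩
    have : {u | (u - c) ^ 2 ∈ Icc p q} = Icc (c - √q) (c + √q) := by
      ext u
      exact ⟨fun h => (sqle u).1 h.2, fun h => ⟨hp.trans (sq_nonneg _), (sqle u).2 h⟩⟩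
    rw [this]
    have hx' : x ∈ Icc (c - √q) (c + √q) := (sqle x).1 hx.2
    ext y
    exact ⟨fun h => h right_mem_uIcc, fun h => ordConnected_Icc.uIcc_subset hx' h⟩
  · refine .inr ⟨hp, ?_⟩
    have hsp := Real.sqrt_pos.2 hp
    have lesq : ∀ u : ℝ, p ≤ (u - c) ^ 2 ↔ c + √p ≤ u ∨ u ≤ c - √p := fun u => by
      rw [← Real.sqrt_le_sqrt_iff (sq_nonneg _), Real.sqrt_sq_eq_abs, le_abs]
      refine or_congr ?_ ?_ <;> constructor <;> intro h <;> linarith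
    -- For `p > 0` the point `c` is outside the preimage, so a component cannot cross it.
    have hcn : ∀ {y}, c ∈ uIcc x y → y ∉ ordConnectedComponent {u | (u - c) ^ 2 ∈ Icc p q} x :=
      fun hc h => by
        have := (h hc).1
        rw [sub_self] at this
        norm_num at this
        linarith
    have hx' := (sqle x).1 hx.2
    rcases (lesq x).1 hx.1 with h | h
    · left
      have hxm : x ∈ Icc (c + √p) (c + √q) := ⟨h, hx'.2⟩
      ext y
      constructor
      · intro hy
        have h1 := hy right_mem_uIcc
        refine ⟨?_, ((sqle y).1 h1.2).2⟩
        refine ((lesq y).1 h1.1).resolve_right fun h2 => hcn ?_ hy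
        rw [mem_uIcc]; right; constructor <;> linarith
      · intro hy z hz
        have := ordConnected_Icc.uIcc_subset hxm hy hz
        exact ⟨(lesq z).2 (.inl this.1), (sqle z).2 ⟨by linarith [this.1, Real.sqrt_nonneg q], this.2⟩⟩
    · right
      have hxm : x ∈ Icc (c - √q) (c - √p) := ⟨hx'.1, h⟩
      ext y
      constructor
      · intro hy
        have h1 := hy right_mem_uIcc
        refine ⟨((sqle y).1 h1.2).1, ?_⟩
        refine ((lesq y).1 h1.1).resolve_left fun h2 => hcn ?_ hy
        rw [mem_uIcc]; left; constructor <;> linarith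
      · intro hy z hz
        have := ordConnected_Icc.uIcc_subset hxm hy hz
        exact ⟨(lesq z).2 (.inr this.2), (sqle z).2 ⟨this.1, by linarith [this.2, Real.sqrt_nonneg q]⟩⟩

end TData

namespace TData
namespace IsExpanding

variable {g : TData} {r R a : ℝ}

/-! ### The critical orbit -/

theorem map_mem_boundary (hg : g.IsExpanding r R a) {W : Set ℝ} (hW : W ∈ g.pieces) {u : ℝ}
    (hu : u ∈ W) (hui : u ∉ interior W) : g.map u = g.c - R ∨ g.map u = g.c + R := by
  by_cases h : W = g.central
  · subst h
    rw [hg.map_central u hu]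
    have him := hg.image_central
    rw [hg.J_eq] at him
    have hphi : g.phi u = r ^ 2 := by
      rw [hg.central_eq] at hu hui
      rw [interior_Icc] at hui
      rw [phi]
      rcases eq_or_lt_of_le hu.1 with h1 | h1
      · rw [← h1]; ring
      rcases eq_or_lt_of_le hu.2 with h2 | h2
      · rw [h2]; ring
      exact absurd ⟨h1, h2⟩ hui
    rw [hphi]
    rcases hg.expanding_central.image_endpoints him with h | h
    · exact .inr h.2
    · exact .inl h.2
  · obtain ⟨α, β, rfl, hexp, him⟩ := hg.branch W hW h
    rw [hg.J_eq] at him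
    rw [interior_Icc] at hui
    have hend := hexp.image_endpoints him
    rcases eq_or_lt_of_le hu.1 with h1 | h1
    · rw [← h1]; exact hend.imp (fun h => h.1) (fun h => h.1) |>.elim .inl .inr
    rcases eq_or_lt_of_le hu.2 with h2 | h2
    · rw [h2]; exact hend.symm.imp (fun h => h.2) (fun h => h.2)
    exact absurd ⟨h1, h2⟩ hui

/-- A point of `∂J` is interior to no interval of the family, so its image is again in `∂J`. A
critical orbit that reached `∂J` would stay there and could not accumulate at `c`. -/
theorem crit_notMem_boundary (hg : g.IsExpanding r R a) (hrec : g.Recurrent) (n : ℕ) :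
    ¬ (g.map^[n] g.c = g.c - R ∨ g.map^[n] g.c = g.c + R) := by
  intro h
  have hr := hg.r_pos
  have hrR := hg.r_lt
  have hall : ∀ m, g.map^[m + n] g.c = g.c - R ∨ g.map^[m + n] g.c = g.c + R := by
    intro m
    induction m with
    | zero => rwa [zero_add]
    | succ m ih =>
      obtain ⟨W, hW, hmem⟩ := hrec.1 (m + n)
      rw [show m + 1 + n = (m + n) + 1 by ring, Function.iterate_succ_apply']
      refine hg.map_mem_boundary hW hmem fun hi => ?_
      have := interior_mono (hg.subset W hW) hi
      rw [hg.J_eq, interior_Icc] at this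
      rcases ih with h | h <;> rw [h] at this
      · exact this.1.ne rfl
      · exact this.2.ne rfl
  have hf := mapClusterPt_iff_frequently.1 hrec.2 (Ioo (g.c - R) (g.c + R))
    (Ioo_mem_nhds (by linarith) (by linarith))
  obtain ⟨m, hm, hmem⟩ := frequently_atTop.1 hf n
  obtain ⟨k, rfl⟩ := Nat.exists_eq_add_of_le' hm
  rcases hall k with h | h <;> rw [h] at hmem
  · exact hmem.1.ne rfl
  · exact hmem.2.ne rfl

theorem crit_mem_interior (hg : g.IsExpanding r R a) (hrec : g.Recurrent) (n : ℕ) {W : Set ℝ}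
    (hW : W ∈ g.pieces) (h : g.map^[n] g.c ∈ W) : g.map^[n] g.c ∈ interior W := by
  by_contra hi
  have := hg.map_mem_boundary hW h hi
  rw [← Function.iterate_succ_apply' g.map] at this
  exact hg.crit_notMem_boundary hrec (n + 1) this

theorem continuousAt_map (hg : g.IsExpanding r R a) {W : Set ℝ} (hW : W ∈ g.pieces) {u : ℝ}
    (hu : u ∈ interior W) : ContinuousAt g.map u := by
  suffices h : ContinuousOn g.map W from h.continuousAt (mem_interior_iff_mem_nhds.1 hu)
  by_cases h : W = g.central
  · subst h
    refine ContinuousOn.congr (f := g.diffeo g.central ∘ g.phi) ?_ hg.map_central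
    refine hg.expanding_central.continuousOn.comp ?_ fun x hx => hg.phi_mem_dom hx
    exact ((continuous_id.sub continuous_const).pow 2).continuousOn
  · obtain ⟨α, β, rfl, hexp, -⟩ := hg.branch W hW h
    exact hexp.continuousOn

theorem continuousAt_iterate (hg : g.IsExpanding r R a) (hrec : g.Recurrent) (n : ℕ) :
    ContinuousAt g.map^[n] g.c := by
  induction n with
  | zero => exact continuousAt_id
  | succ n ih =>
    rw [Function.iterate_succ']
    obtain ⟨W, hW, h⟩ := hrec.1 n
    exact (hg.continuousAt_map hW (hg.crit_mem_interior hrec n hW h)).comp ih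

/-- `g^n` is continuous at `c` and the critical orbit accumulates at `c`. Consequently the
components through points of the critical orbit survive the restriction to those meeting `ω(c)`. -/
theorem iterate_mem_omegaCrit (hg : g.IsExpanding r R a) (hrec : g.Recurrent) (n : ℕ) :
    g.map^[n] g.c ∈ g.omegaCrit := by
  have h : MapClusterPt (g.map^[n] g.c) atTop (fun m : ℕ => g.map^[n] (g.map^[m] g.c)) :=
    MapClusterPt.continuousAt_comp (hg.continuousAt_iterate hrec n) hrec.2
  refine MapClusterPt.of_comp (φ := fun m => n + m) (tendsto_add_atTop_nat n |>.congr
    fun m => add_comm _ _) ?_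
  refine h.congrFun (Eventually.of_forall fun m => ?_)
  simp [Function.iterate_add_apply]

theorem exists_firstReturn (hrec : g.Recurrent) {n : ℕ}
    (hn : g.map^[n] g.c ∈ g.central) {m : ℕ} (hnm : n < m) (hm : g.map^[m] g.c ∈ g.central) :
    ∃ k, g.FirstReturn (g.map^[n] g.c) (k + 1) ∧ n + (k + 1) ≤ m := by
  classical
  have hex : ∃ k, 0 < k ∧ g.map^[n + k] g.c ∈ g.central :=
    ⟨m - n, by omega, by rwa [Nat.add_sub_of_le hnm.le]⟩
  have key : ∀ j, g.map^[j] (g.map^[n] g.c) = g.map^[n + j] g.c := fun j => by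
    rw [add_comm, Function.iterate_add_apply]
  obtain ⟨h1, h2⟩ := Nat.find_spec hex
  obtain ⟨k, hk⟩ : ∃ k, Nat.find hex = k + 1 := ⟨Nat.find hex - 1, by omega⟩
  rw [hk] at h1 h2
  refine ⟨k, ⟨hn, h1, fun j _ => key j ▸ hrec.1 _, fun j h0 hj h => ?_, key _ ▸ h2⟩, ?_⟩
  · rw [key] at h
    exact Nat.find_min hex (hk ▸ hj) ⟨h0, h⟩
  · have : Nat.find hex ≤ m - n := Nat.find_min' hex ⟨by omega, by rwa [Nat.add_sub_of_le hnm.le]⟩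
    omega

theorem frequently_mem (hrec : g.Recurrent) {U : Set ℝ} (hU : U ∈ 𝓝 g.c) (n : ℕ) :
    ∃ m, n < m ∧ g.map^[m] g.c ∈ U := by
  obtain ⟨m, hm, h⟩ := frequently_atTop.1 (mapClusterPt_iff_frequently.1 hrec.2 U hU) (n + 1)
  exact ⟨m, hm, h⟩

theorem central_mem_nhds (hg : g.IsExpanding r R a) : g.central ∈ 𝓝 g.c := by
  rw [hg.central_eq]
  exact Icc_mem_nhds (by linarith [hg.r_pos]) (by linarith [hg.r_pos])

theorem exists_firstReturn' (hg : g.IsExpanding r R a) (hrec : g.Recurrent) {n : ℕ}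
    (hn : g.map^[n] g.c ∈ g.central) : ∃ k, g.FirstReturn (g.map^[n] g.c) (k + 1) := by
  obtain ⟨m, hm, h⟩ := frequently_mem hrec hg.central_mem_nhds n
  obtain ⟨k, hk, -⟩ := exists_firstReturn hrec hn hm h
  exact ⟨k, hk⟩

/-! ### The pre-renormalization -/

theorem component_mem_pieces (hg : g.IsExpanding r R a) (hrec : g.Recurrent) {n k : ℕ}
    (hk : g.FirstReturn (g.map^[n] g.c) (k + 1)) :
    g.component (k + 1) (g.map^[n] g.c) ∈ g.prerenorm.pieces ∧
      g.map^[n] g.c ∈ g.component (k + 1) (g.map^[n] g.c) := by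
  have : g.map^[n] g.c ∈ g.component (k + 1) (g.map^[n] g.c) :=
    self_mem_ordConnectedComponent.2 (self_mem_pullback hk)
  exact ⟨⟨⟨_, _, hk, rfl⟩, _, this, hg.iterate_mem_omegaCrit hrec n⟩, this⟩

theorem prerenorm_iterate (hg : g.IsExpanding r R a) (hrec : g.Recurrent) (i : ℕ) :
    ∃ n, g.prerenorm.map^[i] g.c = g.map^[n] g.c ∧ g.map^[n] g.c ∈ g.central := by
  induction i with
  | zero => exact ⟨0, rfl, hg.c_mem⟩
  | succ i ih =>
    obtain ⟨n, h1, h2⟩ := ih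
    obtain ⟨k, hk⟩ := hg.exists_firstReturn' hrec h2
    refine ⟨k + 1 + n, ?_, ?_⟩
    · rw [Function.iterate_succ_apply', h1, Function.iterate_add_apply]
      show g.map^[g.returnTime _] _ = _
      rw [returnTime_eq hk]
    · rw [Function.iterate_add_apply]
      exact hk.2.2.2.2

/-- The first return map skips no visit of the critical orbit to `I`; this transfers recurrence to
the next level. -/
theorem prerenorm_visits (hrec : g.Recurrent) (d : ℕ) :
    ∀ i n, g.prerenorm.map^[i] g.c = g.map^[n] g.c → g.map^[n] g.c ∈ g.central →
      g.map^[n + d] g.c ∈ g.central → ∃ j ≥ i, g.prerenorm.map^[j] g.c = g.map^[n + d] g.c := by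
  induction d using Nat.strong_induction_on with
  | _ d ih =>
    intro i n h1 h2 h3
    rcases Nat.eq_zero_or_pos d with rfl | hd
    · exact ⟨i, le_rfl, h1⟩
    obtain ⟨k, hk, hle⟩ := exists_firstReturn hrec h2 (by omega : n < n + d) h3
    have e : n + d = (k + 1 + n) + (d - (k + 1)) := by omega
    have hnext : g.map^[k + 1 + n] g.c = g.map^[k + 1] (g.map^[n] g.c) :=
      Function.iterate_add_apply _ _ _ _
    obtain ⟨j, hj, hje⟩ := ih (d - (k + 1)) (by omega) (i + 1) (k + 1 + n)
      (by
        rw [Function.iterate_succ_apply', h1, hnext]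
        show g.map^[g.returnTime _] _ = _
        rw [returnTime_eq hk])
      (by rw [hnext]; exact hk.2.2.2.2) (by rwa [← e])
    exact ⟨j, by omega, by rw [hje, e]⟩

theorem recurrent_prerenorm (hg : g.IsExpanding r R a) (hrec : g.Recurrent) :
    g.prerenorm.Recurrent := by
  constructor
  · intro i
    obtain ⟨n, h1, h2⟩ := hg.prerenorm_iterate hrec i
    obtain ⟨k, hk⟩ := hg.exists_firstReturn' hrec h2
    show g.prerenorm.map^[i] g.c ∈ _
    rw [h1]
    exact ⟨_, (hg.component_mem_pieces hrec hk).1, (hg.component_mem_pieces hrec hk).2⟩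
  · show MapClusterPt g.c atTop (fun n : ℕ => g.prerenorm.map^[n] g.c)
    rw [mapClusterPt_iff_frequently]
    intro U hU
    rw [frequently_atTop]
    intro i
    obtain ⟨n, h1, h2⟩ := hg.prerenorm_iterate hrec i
    obtain ⟨m, hm, h⟩ := frequently_mem hrec (inter_mem hU hg.central_mem_nhds) n
    obtain ⟨d, rfl⟩ := Nat.exists_eq_add_of_lt hm
    obtain ⟨j, hj, hje⟩ := prerenorm_visits hrec (d + 1) i n h1 h2 h.2
    exact ⟨j, hj, by rw [hje]; exact h.1⟩

theorem component_eq (hg : g.IsExpanding r R a) {x : ℝ} {k : ℕ} (hx : g.FirstReturn x (k + 1))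
    {p' p q q' : ℝ} (hb : g.IsReturnBranch r a k x p' p q q') :
    (p ≤ 0 ∧ g.component (k + 1) x = Icc (g.c - √q) (g.c + √q)) ∨
    (0 < p ∧ (g.component (k + 1) x = Icc (g.c + √p) (g.c + √q) ∨
      g.component (k + 1) x = Icc (g.c - √q) (g.c - √p))) := by
  rw [component, hg.pullback_succ_eq hx hb]
  exact ordConnectedComponent_sq hb.phi_mem

theorem firstReturn_of_mem_component (hg : g.IsExpanding r R a) {x u : ℝ} {k : ℕ}
    (hx : g.FirstReturn x (k + 1)) (hu : u ∈ g.component (k + 1) x) : g.FirstReturn u (k + 1) :=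
  hg.firstReturn_of_mem hx (ordConnectedComponent_subset hu)

theorem self_mem_component {x : ℝ} {k : ℕ} (hx : g.FirstReturn x k) : x ∈ g.component k x :=
  self_mem_ordConnectedComponent.2 (self_mem_pullback hx)

theorem prerenorm_diffeo (hg : g.IsExpanding r R a) {x : ℝ} {k : ℕ}
    (hx : g.FirstReturn x (k + 1)) : g.prerenorm.diffeo (g.component (k + 1) x) =
      fun z => g.map^[k] (g.diffeo g.central z) := by
  have : g.returnTime '' g.component (k + 1) x = {k + 1} := by
    ext l
    constructor
    · rintro ⟨u, hu, rfl⟩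
      exact returnTime_eq (hg.firstReturn_of_mem_component hx hu)
    · rintro rfl
      exact ⟨x, self_mem_component hx, returnTime_eq hx⟩
  show (fun z => g.map^[sInf (g.returnTime '' g.component (k + 1) x) - 1] _) = _
  rw [this, csInf_singleton, Nat.add_sub_cancel]

theorem prerenorm_dom (hg : g.IsExpanding r R a) {x : ℝ} {k : ℕ} (hx : g.FirstReturn x (k + 1))
    {p' p q q' : ℝ} (hb : g.IsReturnBranch r a k x p' p q q') :
    g.prerenorm.dom (g.component (k + 1) x) = Icc p q := by
  have hsub : Icc p q ⊆ Icc a (r ^ 2) :=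
    Icc_subset_Icc (hb.a_le.trans hb.left_lt.le) (hb.lt_right.le.trans hb.le_sq)
  show {z ∈ g.dom g.central | ∃ u ∈ g.component (k + 1) x, ∃ l, g.FirstReturn u l ∧
    g.diffeo g.central z ∈ g.pullback (l - 1) (g.map u)} = _
  rw [hg.dom_eq]
  ext z
  constructor
  · rintro ⟨hz, u, hu, l, hl, hzl⟩
    have hup := ordConnectedComponent_subset hu
    obtain rfl := firstReturn_unique hl (hg.firstReturn_of_mem hx hup)
    rw [Nat.add_sub_cancel, hg.pullback_eq (hg.map_mem_cylinder hx hup)] at hzl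
    exact (hb.mem_pullback_iff z hz).1 hzl
  · intro hz
    exact ⟨hsub hz, x, self_mem_component hx, k + 1, hx, (hb.mem_pullback_iff z (hsub hz)).2 hz⟩

theorem prerenorm_map_eq (hg : g.IsExpanding r R a) {x u : ℝ} {k : ℕ}
    (hx : g.FirstReturn x (k + 1)) (hu : u ∈ g.component (k + 1) x) :
    g.prerenorm.map u = g.map^[k] (g.diffeo g.central ((u - g.c) ^ 2)) := by
  have h := hg.firstReturn_of_mem_component hx hu
  show g.map^[g.returnTime u] u = _
  rw [returnTime_eq h, Function.iterate_succ_apply, hg.map_central u h.1]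
  rfl

theorem sq_image_right {c p q : ℝ} (hp : 0 ≤ p) (hq : 0 ≤ q) :
    (fun x => (x - c) ^ 2) '' Icc (c + √p) (c + √q) = Icc p q := by
  ext z
  constructor
  · rintro ⟨x, hx, rfl⟩
    have := hx.1
    have := hx.2
    have := Real.sqrt_nonneg p
    exact ⟨(Real.sqrt_le_iff.1 (by linarith)).2, (Real.le_sqrt (by linarith) hq).1 (by linarith)⟩
  · intro hz
    refine ⟨c + √z, ⟨by linarith [Real.sqrt_le_sqrt hz.1], by linarith [Real.sqrt_le_sqrt hz.2]⟩, ?_⟩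
    simp [Real.sq_sqrt (hp.trans hz.1)]

theorem sq_image_left {c p q : ℝ} (hp : 0 ≤ p) (hq : 0 ≤ q) :
    (fun x => (x - c) ^ 2) '' Icc (c - √q) (c - √p) = Icc p q := by
  rw [← sq_image_right (c := c) hp hq]
  ext z
  constructor
  · rintro ⟨x, hx, rfl⟩
    exact ⟨2 * c - x, ⟨by linarith [hx.2], by linarith [hx.1]⟩, by ring⟩
  · rintro ⟨x, hx, rfl⟩
    exact ⟨2 * c - x, ⟨by linarith [hx.2], by linarith [hx.1]⟩, by ring⟩

/-- If `q = 0`, then `x = c` and the critical value sits at the end of the branch, so `c` returns to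
an endpoint of `I`; the critical orbit only visits interiors. -/
theorem right_pos (hg : g.IsExpanding r R a) (hrec : g.Recurrent) {x : ℝ} {k : ℕ}
    (hx : g.FirstReturn x (k + 1)) {p' p q q' : ℝ} (hb : g.IsReturnBranch r a k x p' p q q') :
    0 < q := by
  have hphi : 0 ≤ g.phi x := sq_nonneg _
  refine lt_of_le_of_ne (hphi.trans hb.phi_mem.2) fun hq => ?_
  have hx0 : g.phi x = 0 := le_antisymm (hq ▸ hb.phi_mem.2) hphi
  obtain rfl : x = g.c := sub_eq_zero.1 (pow_eq_zero_iff two_ne_zero |>.1 hx0)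
  have hret := hg.crit_mem_interior hrec (k + 1) hg.central_mem hx.2.2.2.2
  have hint : interior g.central = Ioo (g.c - r) (g.c + r) := by rw [hg.central_eq, interior_Icc]
  rw [Function.iterate_succ_apply, hg.map_central _ hg.c_mem, hx0, hq, hint] at hret
  have hF := hb.expanding.restrict hb.left_lt.le hb.lt hb.lt_right.le
  rcases hF.image_endpoints (hb.image_central.trans hg.central_eq) with h | h
  · exact absurd h.2 hret.2.ne
  · exact absurd h.2 hret.1.ne'

theorem prerenorm (hg : g.IsExpanding r R a) (hrec : g.Recurrent) :
    ∃ r' a', g.prerenorm.IsExpanding r' r a' := by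
  obtain ⟨k, hk⟩ := hg.exists_firstReturn' hrec (n := 0) hg.c_mem
  obtain ⟨p', p, q, q', hb⟩ := hg.exists_returnBranch hk
  have hpiece := hg.component_mem_pieces hrec hk
  have hcomp := hg.component_eq hk hb
  rw [Function.iterate_zero, _root_.id] at hk hb hpiece hcomp
  have h0 : (0 : ℝ) ∈ Icc p q := by
    have := hb.phi_mem
    rwa [phi, sub_self, zero_pow two_ne_zero] at this
  have hdisj : ∀ U ∈ g.prerenorm.pieces, ∀ V ∈ g.prerenorm.pieces, U ≠ V → Disjoint U V := by
    intro U hU V hV hne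
    rw [disjoint_left]
    intro u hu hv
    obtain ⟨k, hk, rfl⟩ := hg.exists_of_mem_piece hU hu
    obtain ⟨l, hl, rfl⟩ := hg.exists_of_mem_piece hV hv
    rw [firstReturn_unique hk hl] at hne
    exact hne rfl
  have hcen : g.prerenorm.central = g.component (k + 1) g.c :=
    central_eq_of_mem hdisj hpiece.1 hpiece.2
  have hcomp : g.component (k + 1) g.c = Icc (g.c - √q) (g.c + √q) := by
    rcases hcomp with h | h
    · exact h.2
    · exact absurd h0.1 (not_le.2 h.1)
  have hq : 0 < q := hg.right_pos hrec hk hb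
  have hF := hb.expanding.restrict hb.left_lt.le hb.lt hb.lt_right.le
  have hsubI : ∀ W ∈ g.prerenorm.pieces, W ⊆ g.central := fun W hW u hu => by
    obtain ⟨k, hk, -⟩ := hg.exists_of_mem_piece hW hu
    exact hk.1
  -- The branch through `c` has domain `[p, q] ∋ φ c = 0`, so the new central interval has radius
  -- `√q` and the new left endpoint is `p ≤ 0`.
  refine ⟨√q, p, Real.sqrt_pos.2 hq, ?_, hg.central_eq, hcen.trans hcomp, hcen ▸ hpiece.1, h0.1, ?_,
    ?_, ?_, ?_, hsubI, hdisj, ?_⟩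
  · rw [Real.sqrt_lt' hg.r_pos]
    exact hb.lt_right.trans_le hb.le_sq
  · rw [hcen, hg.prerenorm_dom hk hb, Real.sq_sqrt hq.le]
  · rw [hcen, hg.prerenorm_diffeo hk, Real.sq_sqrt hq.le]
    exact hF
  · rw [hcen, hg.prerenorm_diffeo hk, Real.sq_sqrt hq.le]
    exact hb.image_central
  · intro x hx
    rw [hcen] at hx ⊢
    rw [hg.prerenorm_diffeo hk, hg.prerenorm_map_eq hk hx]
    rfl
  · intro W hW hne
    obtain ⟨u, hu⟩ := piece_nonempty hW
    obtain ⟨l, hl, rfl⟩ := hg.exists_of_mem_piece hW hu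
    obtain ⟨s', s, t, t', hs⟩ := hg.exists_returnBranch hl
    have hmap : EqOn g.prerenorm.map ((fun z => g.map^[l] (g.diffeo g.central z)) ∘
      fun x => (x - g.c) ^ 2) (g.component (l + 1) u) := fun v hv => hg.prerenorm_map_eq hl hv
    have hFs := hs.expanding.restrict hs.left_lt.le hs.lt hs.lt_right.le
    rcases hg.component_eq hl hs with ⟨h1, h2⟩ | ⟨h1, h2⟩
    · exfalso
      refine hne (central_eq_of_mem hdisj hW ?_).symm
      show g.c ∈ _
      rw [h2]
      exact ⟨by linarith [Real.sqrt_nonneg t], by linarith [Real.sqrt_nonneg t]⟩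
    · have hst := Real.sqrt_lt_sqrt h1.le hs.lt
      have hsp := Real.sqrt_pos.2 h1
      rcases h2 with h2 | h2
      · have him := sq_image_right (c := g.c) h1.le (h1.trans hs.lt).le
        rw [h2] at hmap
        refine ⟨_, _, h2, ?_, ?_⟩
        · exact (hFs.comp (CrossExpanding.sq_right g.c (by linarith) (by linarith))
            fun x hx => him ▸ mem_image_of_mem _ hx).congr hmap
        · rw [hmap.image_eq, image_comp, him, hs.image_central]
          rfl
      · have him := sq_image_left (c := g.c) h1.le (h1.trans hs.lt).le
        rw [h2] at hmap
        refine ⟨_, _, h2, ?_, ?_⟩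
        · exact (hFs.comp (CrossExpanding.sq_left g.c (by linarith) (by linarith))
            fun x hx => him ▸ mem_image_of_mem _ hx).congr hmap
        · rw [hmap.image_eq, image_comp, him, hs.image_central]
          rfl

end IsExpanding

theorem isExpanding_level {g : TData} (hg : g.ClassT) (hrec : g.Recurrent) (n : ℕ) :
    (∃ r R a, (g.level n).IsExpanding r R a) ∧ (g.level n).Recurrent := by
  induction n with
  | zero => exact ⟨hg.isExpanding, hrec⟩
  | succ n ih =>
    obtain ⟨⟨r, R, a, h⟩, hr⟩ := ih
    obtain ⟨r', a', h'⟩ := h.prerenorm hr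
    exact ⟨⟨r', r, a', h'⟩, h.recurrent_prerenorm hr⟩

end TData

/-! ### Real estimates -/

theorem CrossExpanding.preimage_space {f : ℝ → ℝ} {a b p q A B α β : ℝ}
    (hf : CrossExpanding f a b) (him : f '' Icc a b = Icc A B) (hpq : f '' Icc p q = Icc α β)
    (hap : a < p) (hlt : p < q) (hqb : q < b) (hAα : A < α) (hαβ : α < β) (hβB : β < B) :
    (q - p) * (b - a) * ((α - A) * (B - β)) ≤ (β - α) * (B - A) * ((p - a) * (b - q)) := by
  have h := hf.cross a p q b le_rfl hap hlt hqb le_rfl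
  have hr := hf.restrict hap.le hlt hqb.le
  have hpm : p ∈ Icc a b := ⟨hap.le, by linarith⟩
  have hqm : q ∈ Icc a b := ⟨by linarith, hqb.le⟩
  have ham : a ∈ Icc a b := ⟨le_rfl, by linarith⟩
  have hbm : b ∈ Icc a b := ⟨by linarith, le_rfl⟩
  have orient : (f a < f b ∧ f p < f q) ∨ (f b < f a ∧ f q < f p) := by
    rcases hf.mono with m | m
    · exact .inl ⟨m ham hbm hf.lt, m hpm hqm hlt⟩
    · exact .inr ⟨m ham hbm hf.lt, m hpm hqm hlt⟩
  rcases hf.image_endpoints him with ⟨h1, h2⟩ | ⟨h1, h2⟩ <;>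
  rcases hr.image_endpoints hpq with ⟨h3, h4⟩ | ⟨h3, h4⟩ <;>
  rw [h1, h2, h3, h4] at orient h
  · rwa [abs_of_pos (by linarith), abs_of_pos (by linarith), abs_of_pos (by linarith),
      abs_of_pos (by linarith)] at h
  · rcases orient with o | o <;> linarith [o.1, o.2]
  · rcases orient with o | o <;> linarith [o.1, o.2]
  · rw [abs_of_neg (by linarith), abs_of_neg (by linarith), abs_of_neg (by linarith),
      abs_of_neg (by linarith)] at h
    linarith

theorem space_of_mul_le {θ x y u v : ℝ} (hv : 0 < v) (hx : 0 ≤ x) (hvy : v ≤ y)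
    (h : x * y ≤ θ * (v * u)) : x ≤ θ * u := by
  have : x * v ≤ x * y := mul_le_mul_of_nonneg_left hvy hx
  refine le_of_mul_le_mul_right (?_ : x * v ≤ θ * u * v) hv
  linarith

/-- For `t ≥ r / 2` the factors `t + s ≥ t` and `r + t ≤ 3t` are comparable and the bound stays
linear in `θ`. For `t ≤ r / 2` one has `(t - s)² ≤ t² - s²` and `r² ≤ 4 (r - t)²`, which costs a
square root. -/
theorem sqrt_branch_relative_size {θ r s t : ℝ} (hθ : 0 ≤ θ) (hs : 0 ≤ s) (hst : s < t)
    (htr : t < r) (h : t ^ 2 - s ^ 2 ≤ θ * (r ^ 2 - t ^ 2)) :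
    t - s ≤ (4 * θ + 2 * √θ) * (r - t) := by
  have hq := Real.sqrt_nonneg θ
  have hq2 := Real.sq_sqrt hθ
  rcases le_total (r / 2) t with h2 | h2
  · have h3 : t * (t - s) ≤ t * (4 * θ * (r - t)) := by
      have e1 : t * (t - s) ≤ t ^ 2 - s ^ 2 := by nlinarith
      have e2 : r ^ 2 - t ^ 2 ≤ 3 * t * (r - t) := by nlinarith
      have e3 := mul_le_mul_of_nonneg_left e2 hθ
      have e4 : 0 ≤ θ * (t * (r - t)) := mul_nonneg hθ (mul_nonneg (by linarith) (by linarith))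
      linarith
    have h4 := le_of_mul_le_mul_left h3 (by linarith)
    have h5 : 0 ≤ 2 * √θ * (r - t) := mul_nonneg (by positivity) (by linarith)
    linarith
  · have h3 : (t - s) ^ 2 ≤ (2 * √θ * (r - t)) ^ 2 := by
      have e1 : (t - s) ^ 2 ≤ t ^ 2 - s ^ 2 := by nlinarith
      have e2 : r ^ 2 - t ^ 2 ≤ 4 * (r - t) ^ 2 := by nlinarith
      have e3 := mul_le_mul_of_nonneg_left e2 hθ
      rw [mul_pow, mul_pow, hq2]
      linarith
    have h4 := abs_le_of_sq_le_sq' h3 (mul_nonneg (by positivity) (by linarith)) |>.2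
    have h5 : 0 ≤ 4 * θ * (r - t) := mul_nonneg (by positivity) (by linarith)
    linarith

theorem sqrt_gap_noncentral {θ s t u : ℝ} (hθ : 0 < θ) (hs : 0 ≤ s) (hst : s < t) (htu : t ≤ u)
    (h : t ^ 2 - s ^ 2 ≤ θ * (u ^ 2 - t ^ 2)) : t - s ≤ 2 * √θ * (u - s) := by
  have hq := Real.sqrt_pos.2 hθ
  have hq2 := Real.sq_sqrt hθ.le
  rcases le_total (2 * t) u with h2 | h2
  · have h3 : (t - s) ^ 2 ≤ (2 * √θ * (u - s)) ^ 2 := by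
      have e1 : (t - s) ^ 2 ≤ t ^ 2 - s ^ 2 := by nlinarith
      have e2 : u ^ 2 - t ^ 2 ≤ 4 * (u - s) ^ 2 := by nlinarith
      have e3 := mul_le_mul_of_nonneg_left e2 hθ.le
      rw [mul_pow, mul_pow, hq2]
      linarith
    exact abs_le_of_sq_le_sq' h3 (mul_nonneg (by positivity) (by linarith)) |>.2
  · have h3 : t * (t - s) ≤ t * (3 * θ * (u - t)) := by
      have e1 : t * (t - s) ≤ t ^ 2 - s ^ 2 := by nlinarith
      have e2 : u ^ 2 - t ^ 2 ≤ 3 * t * (u - t) := by nlinarith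
      have e3 := mul_le_mul_of_nonneg_left e2 hθ.le
      linarith
    have h4 := le_of_mul_le_mul_left h3 (by linarith)
    rcases le_total (2 * √θ) 1 with h5 | h5
    · have e1 : 3 * θ ≤ 2 * √θ := by nlinarith
      have e2 := mul_le_mul_of_nonneg_right e1 (sub_nonneg.2 htu)
      have e3 : 0 ≤ 2 * √θ * (t - s) := mul_nonneg (by positivity) (by linarith)
      linarith
    · have e2 := mul_le_mul_of_nonneg_right h5 (by linarith : 0 ≤ u - s)
      linarith

/-- Here `2t` is the length of a central interval and `u + t` is that length plus the gap `u - t`.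
-/
theorem sqrt_gap_central {θ t u : ℝ} (hθ : 0 < θ) (ht : 0 < t) (htu : t ≤ u)
    (h : t ^ 2 ≤ θ * (u ^ 2 - t ^ 2)) : 2 * t ≤ 2 * √θ * (u + t) := by
  have hq := Real.sqrt_pos.2 hθ
  have h3 : t ^ 2 ≤ (√θ * u) ^ 2 := by
    rw [mul_pow, Real.sq_sqrt hθ.le]
    nlinarith
  have h4 := abs_le_of_sq_le_sq' h3 (mul_nonneg hq.le (by linarith)) |>.2
  have : 0 ≤ √θ * t := by positivity
  linarith

theorem logRatio_le {x y A : ℝ} (hy : 0 < y) (hx : 0 ≤ x) (h : x ≤ A * y) :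
    logRatio x y ≤ ENNReal.ofReal A := by
  rw [logRatio, if_pos hy]
  refine ENNReal.ofReal_le_ofReal ?_
  have h1 : x / y ≤ A := (div_le_iff₀ hy).2 h
  have h2 : 0 ≤ x / y := by positivity
  have := Real.log_le_sub_one_of_pos (by linarith : 0 < 1 + x / y)
  linarith

theorem le_logRatio {x y B : ℝ} (hy : 0 < y) (hB : 0 < B) (h : y ≤ B * (x + y)) :
    ENNReal.ofReal (Real.log (1 / B)) ≤ logRatio x y := by
  rw [logRatio, if_pos hy]
  refine ENNReal.ofReal_le_ofReal (Real.log_le_log (by positivity) ?_)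
  rw [div_le_iff₀ hB]
  have : (1 + x / y) * B = B * (x + y) / y := by field_simp; ring
  rw [this, le_div_iff₀ hy]
  linarith

theorem lo_Icc {a b : ℝ} (h : a ≤ b) : lo (Icc a b) = a := csInf_Icc h

theorem hi_Icc {a b : ℝ} (h : a ≤ b) : hi (Icc a b) = b := csSup_Icc h

theorem len_Icc {a b : ℝ} (h : a ≤ b) : len (Icc a b) = b - a := by rw [len, lo_Icc h, hi_Icc h]

/-- A ratio `θ` at the outer interval counts with weight `1/2`, a ratio `2√θ` at the inner one with
weight `1`; both yield `½ log (1/θ)`, up to the `log 2` from the factor `2`. -/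
theorem le_asymLength {U V : Set ℝ} {θ : ℝ} (hθ : 0 < θ) (hU : 0 < len U) (hV : 0 < len V)
    (h : len V ≤ θ * gapLen U V ∨ len U ≤ 2 * √θ * (gapLen U V + len U)) :
    ENNReal.ofReal (1 / 2 * Real.log (1 / θ) - Real.log 2) ≤ asymLength U V := by
  have hq := Real.sqrt_pos.2 hθ
  have hlog2 : 0 ≤ Real.log 2 := Real.log_nonneg (by norm_num)
  rcases h with h | h
  · refine le_trans ?_ le_add_self
    have h1 := le_logRatio (x := gapLen U V) hV hθ (h.trans (by
      have := mul_pos hθ hV; linarith))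
    refine le_trans ?_ (ENNReal.div_le_div_right h1 2)
    have e2 : (2 : ℝ≥0∞) = ENNReal.ofReal 2 := by simp
    rw [e2, ← ENNReal.ofReal_div_of_pos (by norm_num)]
    exact ENNReal.ofReal_le_ofReal (by linarith)
  · refine le_trans ?_ le_self_add
    refine le_trans (ENNReal.ofReal_le_ofReal ?_) (le_logRatio hU (by positivity) h)
    rw [one_div θ, one_div (2 * √θ), Real.log_inv, Real.log_inv, Real.log_mul (by norm_num) hq.ne',
      Real.log_sqrt hθ.le]
    linarith

namespace TData
namespace IsExpanding

variable {g : TData} {r R a : ℝ}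

/-! ### Geometry of the pre-renormalization -/

theorem len_central (hg : g.IsExpanding r R a) : len g.central = 2 * r := by
  rw [hg.central_eq, len_Icc (by linarith [hg.r_pos])]; ring

theorem mu_eq (hg : g.IsExpanding r R a) : g.mu = r / R := by
  have := hg.r_pos
  have := hg.r_lt
  rw [mu, hg.len_central, hg.J_eq, len_Icc (by linarith), show g.c + R - (g.c - R) = 2 * R by ring,
    mul_div_mul_left _ _ two_ne_zero]

variable {θ : ℝ} {x p' p q q' : ℝ} {k : ℕ}

/-- The hypothesis on `θ` bounds the cross ratio of `I` in `J`; pulling back by an expanding branch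
can only decrease it. -/
theorem branch_space (hg : g.IsExpanding r R a) (hθ : 4 * r * R ≤ θ * (R - r) ^ 2)
    (hb : g.IsReturnBranch r a k x p' p q q') :
    (q - p) * (q' - p') ≤ θ * ((p - p') * (q' - q)) := by
  have hr := hg.r_pos
  have hrR := hg.r_lt
  have h := hb.expanding.preimage_space (hb.image_J.trans hg.J_eq)
    (hb.image_central.trans hg.central_eq) hb.left_lt hb.lt hb.lt_right
    (by linarith) (by linarith) (by linarith)
  have hpos : 0 < (R - r) ^ 2 := by have := sub_pos.2 hrR; positivity
  have hlr : 0 ≤ (p - p') * (q' - q) :=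
    mul_nonneg (sub_nonneg.2 hb.left_lt.le) (sub_nonneg.2 hb.lt_right.le)
  have h2 := mul_le_mul_of_nonneg_right hθ hlr
  refine le_of_mul_le_mul_right (?_ : _ * (R - r) ^ 2 ≤ _ * (R - r) ^ 2) hpos
  linarith

theorem right_space (hg : g.IsExpanding r R a) (hθ : 4 * r * R ≤ θ * (R - r) ^ 2)
    (hb : g.IsReturnBranch r a k x p' p q q') : q - p ≤ θ * (q' - q) := by
  have h1 := hb.left_lt
  have h2 := hb.lt
  have h3 := hb.lt_right
  exact space_of_mul_le (sub_pos.2 h1) (by linarith) (by linarith)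
    (hg.branch_space hθ hb)

theorem left_space (hg : g.IsExpanding r R a) (hθ : 4 * r * R ≤ θ * (R - r) ^ 2)
    (hb : g.IsReturnBranch r a k x p' p q q') : q - p ≤ θ * (p - p') := by
  have h1 := hb.left_lt
  have h2 := hb.lt
  have h3 := hb.lt_right
  refine space_of_mul_le (sub_pos.2 h3) (by linarith) (?_ : _ ≤ q' - p')
    (by have := hg.branch_space hθ hb; linarith)
  linarith

theorem theta_pos (hg : g.IsExpanding r R a) (hθ : 4 * r * R ≤ θ * (R - r) ^ 2) : 0 < θ := by
  have hr := hg.r_pos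
  have hrR := hg.r_lt
  by_contra h
  have : θ * (R - r) ^ 2 ≤ 0 := mul_nonpos_of_nonpos_of_nonneg (not_lt.1 h) (sq_nonneg _)
  have : 0 < 4 * r * R := mul_pos (by linarith) (by linarith)
  linarith

theorem prerenorm_lam_le (hg : g.IsExpanding r R a) (hθ : 4 * r * R ≤ θ * (R - r) ^ 2) :
    g.prerenorm.lam ≤ ENNReal.ofReal (2 * (4 * θ + 2 * √θ)) := by
  have hθ0 := hg.theta_pos hθ
  have hr := hg.r_pos
  refine iSup₂_le fun W hW => iSup_le fun hc => ?_
  obtain ⟨u, hu⟩ := piece_nonempty hW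
  obtain ⟨l, hl, rfl⟩ := hg.exists_of_mem_piece hW hu
  obtain ⟨p', p, q, q', hb⟩ := hg.exists_returnBranch hl
  have hsp := hg.right_space hθ hb
  have hlt := hb.lt
  have hrq : q < r ^ 2 := hb.lt_right.trans_le hb.le_sq
  have hqq := hb.le_sq
  rcases hg.component_eq hl hb with ⟨h1, h2⟩ | ⟨h1, h2⟩
  · refine absurd ?_ hc
    show g.c ∈ _
    rw [h2]
    exact ⟨by linarith [Real.sqrt_nonneg q], by linarith [Real.sqrt_nonneg q]⟩
  have hst := Real.sqrt_lt_sqrt h1.le hlt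
  have hs := Real.sqrt_pos.2 h1
  have htr : √q < r := (Real.sqrt_lt' hr).2 hrq
  have key : √q - √p ≤ (4 * θ + 2 * √θ) * (r - √q) := by
    refine sqrt_branch_relative_size hθ0.le hs.le hst htr ?_
    rw [Real.sq_sqrt h1.le, Real.sq_sqrt (h1.trans hlt).le]
    have := mul_le_mul_of_nonneg_left (by linarith : q' - q ≤ r ^ 2 - q) hθ0.le
    linarith
  have hA : 0 ≤ 4 * θ + 2 * √θ := by positivity
  have key2 : √q - √p ≤ (4 * θ + 2 * √θ) * (r + √p) :=
    key.trans (mul_le_mul_of_nonneg_left (by linarith) hA)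
  rw [two_mul, ENNReal.ofReal_add hA hA]
  show poincareLength _ g.central ≤ _
  rw [poincareLength, hg.central_eq]
  rcases h2 with h2 | h2 <;> rw [h2, lo_Icc (by linarith), lo_Icc (by linarith), hi_Icc (by linarith),
    hi_Icc (by linarith), len_Icc (by linarith)] <;>
  refine add_le_add (logRatio_le (by linarith) (by linarith) ?_)
    (logRatio_le (by linarith) (by linarith) ?_)
  · convert key2 using 1 <;> ring
  · convert key using 1 <;> ring
  · convert key using 1 <;> ring
  · convert key2 using 1 <;> ring

theorem exists_crit_branch (hg : g.IsExpanding r R a) (hrec : g.Recurrent) :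
    ∃ k p' p q q', g.FirstReturn g.c (k + 1) ∧ g.IsReturnBranch r a k g.c p' p q q' ∧ p ≤ 0 ∧
      0 < q ∧ g.prerenorm.mu = √q / r := by
  obtain ⟨r', a', hg'⟩ := hg.prerenorm hrec
  have hc : g.c ∈ g.prerenorm.central := hg'.c_mem
  obtain ⟨k, hk, hW⟩ := hg.exists_of_mem_piece hg'.central_mem hc
  obtain ⟨p', p, q, q', hb⟩ := hg.exists_returnBranch hk
  have hq := hg.right_pos hrec hk hb
  have hp : p ≤ 0 := by
    have := hb.phi_mem.1
    rwa [phi, sub_self, zero_pow two_ne_zero] at this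
  refine ⟨k, p', p, q, q', hk, hb, hp, hq, ?_⟩
  rw [hg'.mu_eq]
  rcases hg.component_eq hk hb with ⟨-, h2⟩ | ⟨h1, -⟩
  · have h3 := congrArg len hW
    rw [hg'.len_central, h2, len_Icc (by linarith [Real.sqrt_nonneg q])] at h3
    rw [show r' = √q by linarith]
  · linarith

/-- On the critical branch `p ≤ 0`, so `q ≤ q - p ≤ θ (q' - q) ≤ θ r²`, and `μ' = √q / r`. -/
theorem prerenorm_mu_le (hg : g.IsExpanding r R a) (hrec : g.Recurrent)
    (hθ : 4 * r * R ≤ θ * (R - r) ^ 2) : g.prerenorm.mu ≤ √θ := by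
  obtain ⟨k, p', p, q, q', hk, hb, hp, hq, hmu⟩ := hg.exists_crit_branch hrec
  have hθ0 := hg.theta_pos hθ
  have hr := hg.r_pos
  rw [hmu, div_le_iff₀ hr, ← Real.sqrt_sq hr.le, ← Real.sqrt_mul hθ0.le]
  refine Real.sqrt_le_sqrt ?_
  have := hg.right_space hθ hb
  have := mul_le_mul_of_nonneg_left (by linarith [hb.le_sq] : q' - q ≤ r ^ 2) hθ0.le
  linarith

/-- Let `[s, t]` be the `h₀`-preimage of the interval `W` containing `g c`. Its cross ratio in `[a,
r²]` is at most `2λ` and it contains `[p', q']`, so `q' - q ≤ 2λ r²`; combine this with `q ≤ θ (q' -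
q)`. -/
theorem prerenorm_mu_le_of_nonCentralReturn (hg : g.IsExpanding r R a) (hrec : g.Recurrent)
    (hθ : 4 * r * R ≤ θ * (R - r) ^ 2) (hnc : g.NonCentralReturn) (hlam : g.lam < 1) :
    g.prerenorm.mu ≤ √(2 * θ * g.lam.toReal) := by
  obtain ⟨k, p', p, q, q', hk, hb, hp, hq, hmu⟩ := hg.exists_crit_branch hrec
  have hθ0 := hg.theta_pos hθ
  have hr := hg.r_pos
  set Λ := g.lam.toReal with hΛ
  have hΛ0 : 0 ≤ Λ := ENNReal.toReal_nonneg
  have hΛ1 : Λ ≤ 1 := by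
    have := ENNReal.toReal_mono ENNReal.one_ne_top hlam.le
    simpa using this
  -- the interval of the family containing the critical value
  obtain ⟨k, rfl⟩ : ∃ l, k = l + 1 := by
    cases k with
    | zero => exact absurd hk.2.2.2.2 hnc
    | succ l => exact ⟨l, rfl⟩
  obtain ⟨W, hW, hcW⟩ := hk.2.2.1 1 (by omega)
  rw [Function.iterate_one] at hcW
  have hne : W ≠ g.central := fun h => hnc (h ▸ hcW)
  have hcW' : g.c ∉ W := fun h => hne (hg.eq_of_mem hW hg.central_mem h hg.c_mem)
  have hP : poincareLength W g.J ≤ g.lam :=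
    (le_iSup₂_of_le W hW (le_iSup_of_le hcW' le_rfl) :
      poincareLength W g.J ≤ ⨆ W ∈ g.pieces, ⨆ _ : g.c ∉ W, poincareLength W g.J)
  obtain ⟨α, β, rfl, hexp, -⟩ := hg.branch W hW hne
  have hαβ := hexp.lt
  have hrR := hg.r_lt
  rw [poincareLength, hg.J_eq, lo_Icc hαβ.le, hi_Icc hαβ.le, len_Icc hαβ.le, lo_Icc (by linarith),
    hi_Icc (by linarith)] at hP
  have hPtop := (hP.trans_lt hlam).trans ENNReal.one_lt_top
  have hl : 0 < α - (g.c - R) := by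
    by_contra h
    rw [logRatio, if_neg h, top_add] at hPtop
    exact hPtop.ne rfl
  have hn : 0 < g.c + R - β := by
    by_contra h
    rw [logRatio, logRatio, if_neg h, add_top] at hPtop
    exact hPtop.ne rfl
  have hm : 0 < β - α := sub_pos.2 hαβ
  -- The cross ratio of `W` in `J` is `e^P - 1`, and `e^Λ - 1 ≤ Λ + Λ² ≤ 2Λ` for `0 ≤ Λ ≤ 1`.
  have hmul : (β - α) * (g.c + R - (g.c - R)) ≤ 2 * Λ * ((α - (g.c - R)) * (g.c + R - β)) := by
    rw [logRatio, logRatio, if_pos hl, if_pos hn] at hP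
    have e : g.c + R - (g.c - R) = (α - (g.c - R)) + (β - α) + (g.c + R - β) := by ring
    rw [e]
    generalize α - (g.c - R) = l at *
    generalize g.c + R - β = n at *
    generalize β - α = m at *
    have h1 : 0 < 1 + m / l := by positivity
    have h2 : 0 < 1 + m / n := by positivity
    have hl0 : 0 ≤ Real.log (1 + m / l) := Real.log_nonneg (by have : 0 < m / l := by positivity
                                                               linarith)
    have hn0 : 0 ≤ Real.log (1 + m / n) := Real.log_nonneg (by have : 0 < m / n := by positivity
                                                               linarith)
    rw [← ENNReal.ofReal_add hl0 hn0, ← Real.log_mul h1.ne' h2.ne'] at hP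
    have h3 : Real.log ((1 + m / l) * (1 + m / n)) ≤ Λ :=
      (ENNReal.ofReal_le_iff_le_toReal hlam.ne_top).1 hP
    rw [Real.log_le_iff_le_exp (by positivity)] at h3
    have h4 := (abs_le.1 (Real.abs_exp_sub_one_sub_id_le (x := Λ) (by rwa [abs_of_nonneg hΛ0]))).2
    have h5 : (1 + m / l) * (1 + m / n) = 1 + m * (l + m + n) / (l * n) := by
      field_simp
      ring
    have h6 : m * (l + m + n) / (l * n) ≤ 2 * Λ := by nlinarith
    rwa [div_le_iff₀ (by positivity)] at h6
  obtain ⟨s, t, h1, h2, h3, h4, h5, h6⟩ := hg.expanding_central.preimage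
    (hg.image_central.trans hg.J_eq) (sub_pos.1 hl).le hαβ (sub_pos.1 hn).le
  obtain ⟨h6, h7⟩ := h6 (sub_pos.1 hl) (sub_pos.1 hn)
  have hsp := hg.expanding_central.preimage_space (hg.image_central.trans hg.J_eq) h4 h6 h2 h7
    (sub_pos.1 hl) hαβ (sub_pos.1 hn)
  have hst : t - s ≤ 2 * Λ * (r ^ 2 - t) := by
    refine space_of_mul_le (sub_pos.2 h6) (by linarith)
      (by linarith : s - a ≤ r ^ 2 - a) ?_
    have hpos : 0 < (α - (g.c - R)) * (g.c + R - β) := mul_pos hl hn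
    have hnn : 0 ≤ (s - a) * (r ^ 2 - t) := mul_nonneg (by linarith) (by linarith)
    have := mul_le_mul_of_nonneg_right hmul hnn
    refine le_of_mul_le_mul_right (?_ : _ * ((α - (g.c - R)) * (g.c + R - β)) ≤
      _ * ((α - (g.c - R)) * (g.c + R - β))) hpos
    linarith
  have hsub : Icc p' q' ⊆ Icc s t := fun z hz => by
    have hz' : z ∈ Icc a (r ^ 2) := Icc_subset_Icc hb.a_le hb.le_sq hz
    obtain ⟨W, hW', h8, h9⟩ := ((hb.mem_cylinder_iff z hz').2 hz).2 0 k.succ_pos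
    rw [hg.eq_of_mem hW' hW h8 hcW] at h9
    exact (h5 z hz').1 h9
  have hp'q' : p' ≤ q' := hb.expanding.lt.le
  have hs' := (hsub ⟨le_rfl, hp'q'⟩).1
  have ht' := (hsub ⟨hp'q', le_rfl⟩).2
  rw [hmu, div_le_iff₀ hr, ← Real.sqrt_sq hr.le, ← Real.sqrt_mul (by positivity)]
  refine Real.sqrt_le_sqrt ?_
  have i1 := hg.right_space hθ hb
  have i2 : q' - q ≤ 2 * Λ * r ^ 2 := by
    have : 2 * Λ * (r ^ 2 - t) ≤ 2 * Λ * r ^ 2 :=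
      mul_le_mul_of_nonneg_left (by linarith [hb.lt_right]) (by positivity)
    linarith [hb.left_lt, hb.lt]
  have := mul_le_mul_of_nonneg_left i2 hθ0.le
  linarith

/-- Koebe on the extension to `[p', q']`: points of `I` have distances between `R - r` and `R + r`
to `∂J`, so derivatives differ by a factor at most `((R + r) / (R - r))²`. No square root is lost,
because the distortion is that of the diffeomorphism before composition with `φ`. -/
theorem prerenorm_rho_le (hg : g.IsExpanding r R a) :
    g.prerenorm.rho ≤ ENNReal.ofReal (4 * r / (R - r)) := by
  have hr := hg.r_pos
  have hrR := hg.r_lt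
  refine iSup₂_le fun W hW => ?_
  obtain ⟨u, hu⟩ := piece_nonempty hW
  obtain ⟨l, hl, rfl⟩ := hg.exists_of_mem_piece hW hu
  obtain ⟨p', p, q, q', hb⟩ := hg.exists_returnBranch hl
  rw [hg.prerenorm_dom hl hb, hg.prerenorm_diffeo hl]
  have himJ := hb.image_J.trans hg.J_eq
  have himc := hb.image_central.trans hg.central_eq
  have hexp := hb.expanding
  generalize (fun z => g.map^[l] (g.diffeo g.central z)) = F at *
  refine iSup₂_le fun x hx => iSup₂_le fun y hy => ENNReal.ofReal_le_ofReal ?_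
  have hsub : Icc p q ⊆ Ioo p' q' := fun z hz =>
    ⟨hb.left_lt.trans_le hz.1, hz.2.trans_lt hb.lt_right⟩
  have hderiv : ∀ z ∈ Icc p q, derivWithin F (Icc p q) z ≠ 0 ∧
      HasDerivWithinAt F (derivWithin F (Icc p q) z) (Icc p' q') z := fun z hz => by
    obtain ⟨d, h0, hd⟩ := hexp.deriv z (Ioo_subset_Icc_self (hsub hz))
    have : derivWithin F (Icc p q) z = d :=
      (hd.mono (hsub.trans Ioo_subset_Icc_self)).derivWithin (uniqueDiffOn_Icc hb.lt z hz)
    rw [this]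
    exact ⟨h0, hd⟩
  have hmem : ∀ z ∈ Icc p q, g.c - r ≤ F z ∧ F z ≤ g.c + r := fun z hz => by
    have : F z ∈ Icc (g.c - r) (g.c + r) := himc ▸ mem_image_of_mem F hz
    exact this
  have hdist : ∀ z ∈ Icc p q, ∀ e, e = p' ∨ e = q' →
      R - r ≤ |F e - F z| ∧ |F e - F z| ≤ R + r := fun z hz e he => by
    obtain ⟨m1, m2⟩ := hmem z hz
    have : F e = g.c - R ∨ F e = g.c + R := by
      rcases hexp.image_endpoints himJ with h | h <;> rcases he with rfl | rfl
      · exact .inl h.1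
      · exact .inr h.2
      · exact .inr h.1
      · exact .inl h.2
    rcases this with h | h <;> rw [h]
    · rw [abs_of_neg (by linarith)]; constructor <;> linarith
    · rw [abs_of_pos (by linarith)]; constructor <;> linarith
  obtain ⟨hdx, hx'⟩ := hderiv x hx
  obtain ⟨hdy, hy'⟩ := hderiv y hy
  generalize derivWithin F (Icc p q) x = d at *
  generalize derivWithin F (Icc p q) y = e at *
  have hd0 := abs_pos.2 hdx
  have he0 := abs_pos.2 hdy
  have hRr : 0 < R - r := by linarith
  have key : |d| * (R - r) ^ 2 ≤ |e| * (R + r) ^ 2 := by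
    have fin : ∀ z, z = p' ∨ z = q' → |d| * |F z - F y| ^ 2 ≤ |e| * |F z - F x| ^ 2 →
        |d| * (R - r) ^ 2 ≤ |e| * (R + r) ^ 2 := fun z hz h => by
      refine le_trans ?_ (h.trans ?_)
      · exact mul_le_mul_of_nonneg_left (pow_le_pow_left₀ hRr.le (hdist y hy z hz).1 2) hd0.le
      · exact mul_le_mul_of_nonneg_left (pow_le_pow_left₀ (abs_nonneg _) (hdist x hx z hz).2 2)
          he0.le
    rcases lt_trichotomy x y with h | h | h
    · exact fin q' (.inr rfl) (hexp.koebe_right (hsub hx).1.le h (hsub hy).2 hx' hy')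
    · subst h
      have hde : d = e := (uniqueDiffOn_Icc hexp.lt x (Ioo_subset_Icc_self (hsub hx))).eq_deriv
        _ hx' hy'
      rw [hde]
      exact mul_le_mul_of_nonneg_left (pow_le_pow_left₀ hRr.le (by linarith) 2) he0.le
    · exact fin p' (.inl rfl) (hexp.koebe_left (hsub hy).1 h (hsub hx).2.le hy' hx')
  have h1 : |d| / |e| ≤ ((R + r) / (R - r)) ^ 2 := by
    rw [div_pow, div_le_div_iff₀ he0 (by positivity)]
    linarith
  have hM : 0 < (R + r) / (R - r) := div_pos (by linarith) hRr
  calc Real.log (|d| / |e|) ≤ Real.log (((R + r) / (R - r)) ^ 2) :=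
        Real.log_le_log (by positivity) h1
    _ = 2 * Real.log ((R + r) / (R - r)) := by rw [Real.log_pow]; norm_num
    _ ≤ 2 * ((R + r) / (R - r) - 1) := by
        have := Real.log_le_sub_one_of_pos hM
        linarith
    _ = 4 * r / (R - r) := by field_simp; ring

/-- The gap between two pull-backs of `I` is large compared with one of them. -/
theorem branch_gap (hg : g.IsExpanding r R a) (hθ : 4 * r * R ≤ θ * (R - r) ^ 2)
    {x₁ x₂ p₁' p₁ q₁ q₁' p₂' p₂ q₂ q₂' : ℝ} {k₁ k₂ : ℕ}
    (hx₁ : g.FirstReturn x₁ (k₁ + 1)) (hb₁ : g.IsReturnBranch r a k₁ x₁ p₁' p₁ q₁ q₁')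
    (hx₂ : g.FirstReturn x₂ (k₂ + 1)) (hb₂ : g.IsReturnBranch r a k₂ x₂ p₂' p₂ q₂ q₂')
    (hle : q₁ ≤ p₂) : q₂ - p₂ ≤ θ * (p₂ - q₁) ∨ q₁ - p₁ ≤ θ * (p₂ - q₁) := by
  have hθ0 := hg.theta_pos hθ
  have a1 := hb₁.a_le
  have b1 := hb₁.left_lt
  have c1 := hb₁.lt
  have d1 := hb₁.lt_right
  have e1 := hb₁.le_sq
  have a2 := hb₂.a_le
  have b2 := hb₂.left_lt
  have c2 := hb₂.lt
  have d2 := hb₂.lt_right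
  have e2 := hb₂.le_sq
  have hq₁ : q₁ ∈ Icc a (r ^ 2) := ⟨by linarith, by linarith⟩
  have hp₂ : p₂ ∈ Icc a (r ^ 2) := ⟨by linarith, by linarith⟩
  have hq₁' := (hb₁.mem_pullback_iff q₁ hq₁).2 ⟨c1.le, le_rfl⟩
  have hp₂' := (hb₂.mem_pullback_iff p₂ hp₂).2 ⟨le_rfl, c2.le⟩
  have absurd_eq : g.pullback k₁ (g.map x₁) = g.pullback k₂ (g.map x₂) → False := fun h => by
    have hp₁ : p₁ ∈ Icc a (r ^ 2) := ⟨by linarith, by linarith⟩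
    have := (hb₁.mem_pullback_iff p₁ hp₁).2 ⟨le_rfl, c1.le⟩
    rw [h] at this
    linarith [((hb₂.mem_pullback_iff p₁ hp₁).1 this).1]
  -- The branch with the longer return time has the room: its `J`-extension does not reach the other
  -- pull-back of `I`, so its collar facing the other branch lies in the gap.
  rcases le_total k₁ k₂ with hk | hk
  · left
    have hlt : q₁ < p₂' := by
      by_contra h
      have hc := (hb₂.mem_cylinder_iff q₁ hq₁).2 ⟨not_lt.1 h, by linarith⟩
      exact absurd_eq (hg.eq_of_mem_cylinder hx₂ hk hc hq₁').2.symm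
    have := mul_le_mul_of_nonneg_left (by linarith : p₂ - p₂' ≤ p₂ - q₁) hθ0.le
    exact (hg.left_space hθ hb₂).trans this
  · right
    have hlt : q₁' < p₂ := by
      by_contra h
      have hc := (hb₁.mem_cylinder_iff p₂ hp₂).2 ⟨by linarith, not_lt.1 h⟩
      exact absurd_eq (hg.eq_of_mem_cylinder hx₁ hk hc hp₂').2
    have := mul_le_mul_of_nonneg_left (by linarith : q₁' - q₁ ≤ p₂ - q₁) hθ0.le
    exact (hg.right_space hθ hb₁).trans this

/-- This carries `branch_gap` through the square root. If the outer branch has the room, its ratio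
to the gap remains at most `θ`; if the inner one has it, `sqrt_gap_central` or `sqrt_gap_noncentral`
gives `2√θ`. -/
theorem le_prerenorm_gapK (hg : g.IsExpanding r R a) (hrec : g.Recurrent)
    (hθ : 4 * r * R ≤ θ * (R - r) ^ 2) :
    ENNReal.ofReal (1 / 2 * Real.log (1 / θ) - Real.log 2) ≤ g.prerenorm.gapK := by
  have hθ0 := hg.theta_pos hθ
  refine le_iInf₂ fun U hU => le_iInf₂ fun V hV => le_iInf fun hcl => ?_
  obtain ⟨u, hu⟩ := piece_nonempty hU
  obtain ⟨k₁, hx₁, rfl⟩ := hg.exists_of_mem_piece hU hu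
  obtain ⟨p₁', p₁, q₁, q₁', hb₁⟩ := hg.exists_returnBranch hx₁
  obtain ⟨v, hv⟩ := piece_nonempty hV
  obtain ⟨k₂, hx₂, rfl⟩ := hg.exists_of_mem_piece hV hv
  obtain ⟨p₂', p₂, q₂, q₂', hb₂⟩ := hg.exists_returnBranch hx₂
  have hq₁ := hg.right_pos hrec hx₁ hb₁
  have hq₂ := hg.right_pos hrec hx₂ hb₂
  have sq₁ := Real.sqrt_pos.2 hq₁
  have sq₂ := Real.sqrt_pos.2 hq₂
  have shape₁ := hg.component_eq hx₁ hb₁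
  have shape₂ := hg.component_eq hx₂ hb₂
  -- the data of the two intervals on one side of `c`
  have main : ∀ U V : Set ℝ, 0 < p₂ → √q₁ ≤ √p₂ → gapLen U V = √p₂ - √q₁ →
      len V = √q₂ - √p₂ → ((p₁ ≤ 0 ∧ len U = 2 * √q₁) ∨ (0 < p₁ ∧ len U = √q₁ - √p₁)) →
      ENNReal.ofReal (1 / 2 * Real.log (1 / θ) - Real.log 2) ≤ asymLength U V := by
    intro U V hp₂ hle hgap hlenV hlenU
    have hqp : q₁ ≤ p₂ := (Real.sqrt_le_sqrt_iff hp₂.le).1 hle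
    have s2 := Real.sqrt_lt_sqrt hp₂.le hb₂.lt
    have sp₂ := Real.sqrt_pos.2 hp₂
    have hlenU0 : 0 < len U := by
      rcases hlenU with ⟨-, h⟩ | ⟨h0, h⟩ <;> rw [h]
      · positivity
      · exact sub_pos.2 (Real.sqrt_lt_sqrt h0.le hb₁.lt)
    refine le_asymLength hθ0 hlenU0 (by rw [hlenV]; linarith) ?_
    have e1 := Real.sq_sqrt hq₁.le
    have e2 := Real.sq_sqrt hq₂.le
    have e3 := Real.sq_sqrt hp₂.le
    rcases hg.branch_gap hθ hx₁ hb₁ hx₂ hb₂ hqp with h | h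
    · left
      rw [hlenV, hgap]
      rw [← e1, ← e2, ← e3] at h
      -- Factoring differences of squares, the outer sum `√q₂ + √p₂` dominates `√p₂ + √q₁`, so
      -- concavity of the root works in favour of the outer interval.
      refine le_of_mul_le_mul_right (?_ : _ * (√q₂ + √p₂) ≤ _ * (√q₂ + √p₂)) (by positivity)
      have : θ * (√p₂ - √q₁) * (√p₂ + √q₁) ≤ θ * (√p₂ - √q₁) * (√q₂ + √p₂) :=
        mul_le_mul_of_nonneg_left (by linarith) (mul_nonneg hθ0.le (by linarith))
      linarith
    · right
      rcases hlenU with ⟨h0, hl⟩ | ⟨h0, hl⟩ <;> rw [hl, hgap]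
      · have := sqrt_gap_central hθ0 sq₁ hle (by rw [e1, e3]; linarith)
        convert this using 2
        ring
      · have := sqrt_gap_noncentral hθ0 (Real.sqrt_nonneg p₁) (Real.sqrt_lt_sqrt h0.le hb₁.lt) hle
          (by rw [e1, e3, Real.sq_sqrt h0.le]; exact h)
        convert this using 2
        ring
  have l1 : 0 < p₁ → √p₁ < √q₁ := fun h => Real.sqrt_lt_sqrt h.le hb₁.lt
  have l2 : 0 < p₂ → √p₂ < √q₂ := fun h => Real.sqrt_lt_sqrt h.le hb₂.lt
  have n1 := Real.sqrt_nonneg p₁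
  have n2 := Real.sqrt_nonneg p₂
  have hcl' : (g.c ≤ hi (g.component (k₁ + 1) u) ∧
      hi (g.component (k₁ + 1) u) ≤ lo (g.component (k₂ + 1) v)) ∨
      (hi (g.component (k₂ + 1) v) ≤ lo (g.component (k₁ + 1) u) ∧
        lo (g.component (k₁ + 1) u) ≤ g.c) := hcl
  have sp₁ : 0 < p₁ → 0 < √p₁ := Real.sqrt_pos.2
  have icc : ∀ {s t : ℝ}, s ≤ t → lo (Icc s t) = s ∧ hi (Icc s t) = t ∧ len (Icc s t) = t - s :=
    fun h => ⟨lo_Icc h, hi_Icc h, len_Icc h⟩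
  -- Of the nine positions relative to `c` only four are compatible with `IsCloser`: `U` central
  -- with `V` on either side, and both on the right or both on the left.
  rcases shape₁ with ⟨z1, w1⟩ | ⟨z1, w1 | w1⟩
  · obtain ⟨i1, i2, i3⟩ := icc (by linarith : g.c - √q₁ ≤ g.c + √q₁)
    rcases shape₂ with ⟨z2, w2⟩ | ⟨z2, w2 | w2⟩ <;> rw [w1, w2, i1, i2] at hcl' <;> rw [w1, w2]
    · obtain ⟨j1, j2, j3⟩ := icc (by linarith : g.c - √q₂ ≤ g.c + √q₂)
      rw [j1, j2] at hcl'
      rcases hcl' with h | h <;> linarith [h.1, h.2]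
    · have l2 := l2 z2
      obtain ⟨j1, j2, j3⟩ := icc (by linarith : g.c + √p₂ ≤ g.c + √q₂)
      rw [j1, j2] at hcl'
      rcases hcl' with h | h <;> [skip; linarith [h.1, h.2]]
      refine main _ _ z2 (by linarith) ?_ (by rw [j3]; ring) (.inl ⟨z1, by rw [i3]; ring⟩)
      rw [gapLen, i1, i2, j1, j2, max_eq_left (by linarith)]
      ring
    · have l2 := l2 z2
      obtain ⟨j1, j2, j3⟩ := icc (by linarith : g.c - √q₂ ≤ g.c - √p₂)
      rw [j1, j2] at hcl'
      rcases hcl' with h | h <;> [linarith [h.1, h.2]; skip]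
      refine main _ _ z2 (by linarith) ?_ (by rw [j3]; ring) (.inl ⟨z1, by rw [i3]; ring⟩)
      rw [gapLen, i1, i2, j1, j2, max_eq_right (by linarith)]
      ring
  · have l1 := l1 z1
    have sp₁ := sp₁ z1
    obtain ⟨i1, i2, i3⟩ := icc (by linarith : g.c + √p₁ ≤ g.c + √q₁)
    rcases shape₂ with ⟨z2, w2⟩ | ⟨z2, w2 | w2⟩ <;> rw [w1, w2, i1, i2] at hcl' <;> rw [w1, w2]
    · obtain ⟨j1, j2, j3⟩ := icc (by linarith : g.c - √q₂ ≤ g.c + √q₂)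
      rw [j1, j2] at hcl'
      rcases hcl' with h | h <;> linarith [h.1, h.2]
    · have l2 := l2 z2
      obtain ⟨j1, j2, j3⟩ := icc (by linarith : g.c + √p₂ ≤ g.c + √q₂)
      rw [j1, j2] at hcl'
      rcases hcl' with h | h <;> [skip; linarith [h.1, h.2]]
      refine main _ _ z2 (by linarith) ?_ (by rw [j3]; ring) (.inr ⟨z1, by rw [i3]; ring⟩)
      rw [gapLen, i1, i2, j1, j2, max_eq_left (by linarith)]
      ring
    · have l2 := l2 z2
      obtain ⟨j1, j2, j3⟩ := icc (by linarith : g.c - √q₂ ≤ g.c - √p₂)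
      rw [j1, j2] at hcl'
      rcases hcl' with h | h <;> linarith [h.1, h.2]
  · have l1 := l1 z1
    have sp₁ := sp₁ z1
    obtain ⟨i1, i2, i3⟩ := icc (by linarith : g.c - √q₁ ≤ g.c - √p₁)
    rcases shape₂ with ⟨z2, w2⟩ | ⟨z2, w2 | w2⟩ <;> rw [w1, w2, i1, i2] at hcl' <;> rw [w1, w2]
    · obtain ⟨j1, j2, j3⟩ := icc (by linarith : g.c - √q₂ ≤ g.c + √q₂)
      rw [j1, j2] at hcl'
      rcases hcl' with h | h <;> linarith [h.1, h.2]
    · have l2 := l2 z2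
      obtain ⟨j1, j2, j3⟩ := icc (by linarith : g.c + √p₂ ≤ g.c + √q₂)
      rw [j1, j2] at hcl'
      rcases hcl' with h | h <;> linarith [h.1, h.2]
    · have l2 := l2 z2
      obtain ⟨j1, j2, j3⟩ := icc (by linarith : g.c - √q₂ ≤ g.c - √p₂)
      rw [j1, j2] at hcl'
      rcases hcl' with h | h <;> [linarith [h.1, h.2]; skip]
      refine main _ _ z2 (by linarith) ?_ (by rw [j3]; ring) (.inr ⟨z1, by rw [i3]; ring⟩)
      rw [gapLen, i1, i2, j1, j2, max_eq_right (by linarith)]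
      ring

end IsExpanding
end TData

end Renorm

/-! ### The choice of constants and the conclusion -/

theorem lemma3p12 (μbar : ℝ) (hμ0 : 0 < μbar) (hμ1 : μbar < 1) :
    ∃ C : ℝ, 0 < C ∧ ∀ ρbar Kbar : ℝ, 0 < ρbar → ρbar < μbar → 0 < Kbar →
      ∀ g : Renorm.TData, g.ClassT → g.Recurrent → ∀ n : ℕ,
        (g.level n).rho < ENNReal.ofReal ρbar →
        (g.level n).mu < μbar →
        ENNReal.ofReal Kbar < (g.level n).gapK →
          (g.level (n + 1)).lam ≤ ENNReal.ofReal (C * √(g.level n).mu) ∧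
          (g.level (n + 1)).mu ≤ C * √(g.level n).mu ∧
          (g.level (n + 1)).rho ≤ ENNReal.ofReal (C * (g.level n).mu) ∧
          ENNReal.ofReal (1 / 2 * Real.log (1 / (g.level n).mu) - C)
            ≤ (g.level (n + 1)).gapK ∧
          ((g.level n).NonCentralReturn →
            (g.level (n + 1)).mu ≤ C * √((g.level n).mu * (g.level n).lamStar)) := by
  -- Since `R / (R - r) = 1 / (1 - μ) ≤ κ`, the cross ratio `4rR / (R - r)² = 4μ (R / (R - r))²` is
  -- at most `4κ²μ`; so `θ = Kμ` below.
  set κ := 1 / (1 - μbar) with hκ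
  have hκ1 : 1 ≤ κ := by
    rw [hκ, le_div_iff₀ (by linarith)]; linarith
  have hκμ : κ * (1 - μbar) = 1 := by rw [hκ]; field_simp [(by linarith : 1 - μbar ≠ 0)]
  set K := 4 * κ ^ 2 with hK
  have hK4 : 4 ≤ K := by nlinarith
  -- The factor `12` comes from `λ'`: `2 (4θ + 2√θ) ≤ 8Kμ + 4K√μ ≤ 12K√μ`.
  refine ⟨12 * K, by linarith, ?_⟩
  intro _ _ _ _ _ g hg hrec n _ hμ _
  obtain ⟨⟨r, R, a, h⟩, hr⟩ := Renorm.TData.isExpanding_level hg hrec n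
  show (g.level n).prerenorm.lam ≤ _ ∧ (g.level n).prerenorm.mu ≤ _ ∧
    (g.level n).prerenorm.rho ≤ _ ∧ _ ≤ (g.level n).prerenorm.gapK ∧
    (_ → (g.level n).prerenorm.mu ≤ _)
  generalize g.level n = f at *
  have hr0 := h.r_pos
  have hrR := h.r_lt
  have hR : 0 < R := by linarith
  have hmuR : f.mu * R = r := by rw [h.mu_eq]; field_simp
  have hmu0 : 0 < f.mu := by rw [h.mu_eq]; positivity
  generalize hm : f.mu = μ at *
  have hμ1' : μ < 1 := by linarith
  have hsub : R ≤ κ * (R - r) := by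
    have : κ * (R - r) = κ * (1 - μbar) * R + κ * (μbar - μ) * R := by rw [← hmuR]; ring
    rw [this, hκμ]
    have : 0 ≤ κ * (μbar - μ) * R :=
      mul_nonneg (mul_nonneg (by linarith) (by linarith)) hR.le
    linarith
  have hθ : 4 * r * R ≤ (K * μ) * (R - r) ^ 2 := by
    have h1 := pow_le_pow_left₀ hR.le hsub 2
    have h2 := mul_le_mul_of_nonneg_left h1 hmu0.le
    rw [← hmuR] at h2 ⊢
    rw [hK]
    linarith
  have hsμ := Real.sqrt_nonneg μ
  have hsμ2 := Real.sq_sqrt hmu0.le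
  have hsμ1 : √μ ≤ 1 := Real.sqrt_le_one.2 hμ1'.le
  have hμs : μ ≤ √μ := by nlinarith
  have hsK : √K ≤ K := by rw [Real.sqrt_le_left (by linarith)]; nlinarith
  have hsKμ : √(K * μ) ≤ K * √μ := by
    rw [Real.sqrt_mul (by linarith)]
    exact mul_le_mul_of_nonneg_right hsK hsμ
  have hmu' := h.prerenorm_mu_le hr hθ
  have hKs : 0 ≤ K * √μ := mul_nonneg (by linarith) hsμ
  refine ⟨?_, ?_, ?_, ?_, ?_⟩
  · refine (h.prerenorm_lam_le hθ).trans (ENNReal.ofReal_le_ofReal ?_)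
    have := mul_le_mul_of_nonneg_left hμs (by linarith : 0 ≤ K)
    linarith
  · linarith
  · refine h.prerenorm_rho_le.trans (ENNReal.ofReal_le_ofReal ?_)
    rw [div_le_iff₀ (by linarith), ← hmuR]
    have h1 := mul_le_mul_of_nonneg_left hsub (by positivity : 0 ≤ 4 * μ)
    have h2 : 4 * κ ≤ 12 * K := by nlinarith
    have h3 : 0 ≤ μ * (R - μ * R) := by
      rw [hmuR]; exact mul_nonneg hmu0.le (by linarith)
    have h4 := mul_le_mul_of_nonneg_right h2 h3
    rw [← hmuR] at h1
    linarith
  · refine le_trans (ENNReal.ofReal_le_ofReal ?_) (h.le_prerenorm_gapK hr hθ)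
    rw [one_div μ, one_div (K * μ), Real.log_inv, Real.log_inv,
      Real.log_mul (by linarith) hmu0.ne']
    have h1 := Real.log_le_sub_one_of_pos (by linarith : 0 < K)
    have h2 := Real.log_le_sub_one_of_pos (by norm_num : (0 : ℝ) < 2)
    linarith
  · intro hnc
    -- For `λ ≥ 1` one has `λ* = 1` and the general bound on `μ'` suffices.
    rcases lt_or_ge f.lam 1 with hlam | hlam
    · have h1 := h.prerenorm_mu_le_of_nonCentralReturn hr hθ hnc hlam
      have h2 : f.lamStar = f.lam.toReal := by rw [Renorm.TData.lamStar, min_eq_left hlam.le]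
      rw [h2]
      refine h1.trans ?_
      rw [show 2 * (K * μ) * f.lam.toReal = 2 * K * (μ * f.lam.toReal) by ring,
        Real.sqrt_mul (by linarith)]
      refine mul_le_mul_of_nonneg_right ?_ (Real.sqrt_nonneg _)
      rw [Real.sqrt_le_left (by linarith)]
      nlinarith
    · have h2 : f.lamStar = 1 := by rw [Renorm.TData.lamStar, min_eq_right hlam]; simp
      rw [h2, mul_one]
      linarith
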